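/- Let $T$ be a complete first-order theory with NIP, and let $\bar M$ be a universal domain for $T$: $\bar M$ is $\kappa$-saturated for some $\kappa>|T|+2^{\aleph_0}$, and "small" means "of cardinality less than $\kappa$". Let $(a_i : i\in[0,1])$ be an indiscernible segment, i.e. a family of finite tuples of $\bar M$ of the same length that is indiscernible over $\emptyset$ with respect to the usual order of the real interval $[0,1]$. For every formula $\phi(x,b)$ over $\bar M$ the set $\{i\in[0,1] : \bar M\models\phi(a_i,b)\}$ is a finite union of intervals; let $\mu(\phi(x,b))$ be its Lebesgue measure. Then $\mu$ is a global Keisler measure (a finitely additive probability measure on the formulas over $\bar M$), and $\mu$ is generically stable. More precisely: 1. $\mu$ is finitely satisfiable in the segment: if $\mu(\phi(x,b))>0$ then $\bar M\models\phi(a_i,b)$ for some $i\in[0,1]$. 2. $\mu$ is definable over the set $A$ of all coordinates of the $a_i$: for every formula $\phi(x,y)$ of the language without parameters and every closed $C\subseteq[0,1]$, the set $\{b:\mu(\phi(x,b))\in C\}$ is type-definable over $A$. 3. $\mu$ is generically stable: for some small elementary submodel $N\preceq\bar M$, $\mu$ is definable over $N$ and finitely satisfiable in $N$. 4. $\mu$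 is a frequency interpretation measure (fim): $\mu$ is Borel definable over a small set, and for every formula $\phi(x,y)$ of the language without parameters and every $\varepsilon>0$ there are formulas $\theta_m(x_1,\dots,x_m)$ with parameters in $\bar M$ such that $\lim_{m\to\infty}\mu^{(m)}(\theta_m)=1$ and, for all sufficiently large $m$, all $(c_1,\dots,c_m)\models\theta_m$ and all $b$ in $\bar M$, $$\Bigl|\mu(\phi(x,b))-\tfrac1m\,\bigl|\{k\le m:\ \bar M\models\phi(c_k,b)\}\bigr|\Bigr|<\varepsilon .$$ Here Borel definability over a set $B$ means that for every $\phi(x,y)$ without parameters and closed $C\subseteq[0,1]$ the set $\{b:\mu(\phi(x,b))\in C\}$ is the set of realizations of a Borel set of types over $B$. For $\mu$ Borel definable over a small set and any global Keisler measure $\lambda$, the product is $(\mu_x\otimes\lambda_y)(\psi(x,y))=\int f\,d\lambda$, the integral being over the space of global types $q(y)$, where $\lambda$ is identified with the corresponding regular Borel probability measure and $f(q)$ is the measure of $\psi(x,b)$, $b\models q$, for the extension of $\mu$ given by its Borel definition; $\mu^{(1)}=\mu$ and $\mu^{(m+1)}_{x_1,\dots,x_{m+1}}=\mu_{x_{m+1}}\otimes\mu^{(m)}_{x_1,\dots,x_m}$.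 -/

import Mathlib

universe u v w x y

namespace KeislerMeasures

open Set MeasureTheory Filter Topology FirstOrder FirstOrder.Language
open scoped Cardinal

/-! ### Definable sets, instances of formulas, type spaces

Throughout, `M` is an `L`-structure, which plays the role of the universal domain of its complete
theory. A tuple of variables is an index type `α` and a tuple of elements is a map `α → M`. A
"formula over `A` up to equivalence in `M`" is an element of Mathlib's Boolean algebra
`L.DefinableSet A α`. -/

section Definable

variable {L : FirstOrder.Language.{u, v}} {M : Type w} [L.Structure M]

/-- The solution set of a parameter-free formula. -/
def ofFormula {α : Type x} (φ : L.Formula α) : L.DefinableSet (univ : Set M) α :=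
  ⟨{v | φ.Realize v}, (Set.empty_definable_iff.2 ⟨φ, rfl⟩).mono (Set.empty_subset _)⟩

theorem definable_fiber {α : Type x} {β : Type y} {D : Set (α ⊕ β → M)}
    (hD : (univ : Set M).Definable L D) (b : β → M) :
    (univ : Set M).Definable L {a : α → M | Sum.elim a b ∈ D} := by
  rw [Set.definable_iff_exists_formula_sum] at hD ⊢
  obtain ⟨φ, rfl⟩ := hD
  refine ⟨φ.relabel (Sum.elim Sum.inl
    (Sum.elim Sum.inr fun j => Sum.inl ⟨b j, mem_univ _⟩)), ?_⟩
  ext a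
  simp only [mem_ofPred_eq, Formula.realize_relabel]
  refine iff_of_eq (congrArg _ (funext fun i => ?_))
  rcases i with _ | _ | _ <;> rfl

/-- For a definable set `D` of pairs `(x, y)` and a tuple `b`, the definable set
`{x : (x, b) ∈ D}`. -/
def fiber {α : Type x} {β : Type y} (D : L.DefinableSet (univ : Set M) (α ⊕ β)) (b : β → M) :
    L.DefinableSet (univ : Set M) α :=
  ⟨{a | Sum.elim a b ∈ (D : Set (α ⊕ β → M))}, definable_fiber D.2 b⟩

/-- The instance `φ(x, b)` of a formula `φ(x, y)`. -/
def inst {α : Type x} {β : Type y} (φ : L.Formula (α ⊕ β)) (b : β → M) :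
    L.DefinableSet (univ : Set M) α :=
  fiber (ofFormula φ) b

/-- Change of variables: `{v : v ∘ g ∈ D}`. -/
def pullback {α : Type x} {β : Type y} (g : α → β) (D : L.DefinableSet (univ : Set M) α) :
    L.DefinableSet (univ : Set M) β :=
  ⟨{v | v ∘ g ∈ (D : Set (α → M))}, Set.Definable.preimage_comp g D.2⟩

variable (L) in
/-- The space `S_α(A)` of complete types over `A` in the variables `α`, with the logic topology. -/
abbrev TypeSpace (A : Set M) (α : Type x) :=
  (L[[A]].completeTheory M).CompleteType α

/-- Type spaces carry the Borel sigma-algebra of the logic topology. -/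
instance instMeasurableSpaceTypeSpace {A : Set M} {α : Type x} :
    MeasurableSpace (TypeSpace L A α) :=
  borel _

instance instBorelSpaceTypeSpace {A : Set M} {α : Type x} : BorelSpace (TypeSpace L A α) :=
  ⟨rfl⟩

variable (L) in
/-- The type `tp(b / A)`. -/
def tp [Nonempty M] (A : Set M) {α : Type x} (b : α → M) : TypeSpace L A α :=
  (L[[A]].completeTheory M).typeOf b

/-- The set of global types that contain (a formula defining) `D`. -/
def typesIn {α : Type x} (D : Set (α → M)) : Set (TypeSpace L (univ : Set M) α) :=
  {q | ∃ φ : L[[(univ : Set M)]].Formula α,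
    D = {v | φ.Realize v} ∧ Formula.equivSentence φ ∈ q}

/-- The tuple `b` of `M` realizes the restriction to `B` of the global type `q`. -/
def RealizesOver {α : Type x} (B : Set M) (q : TypeSpace L (univ : Set M) α) (b : α → M) : Prop :=
  ∀ D : Set (α → M), B.Definable L D → (q ∈ typesIn D ↔ b ∈ D)

/-- `X` is a closed set over `A` (that is, type-definable over `A`): the set of realizations of a
closed set of types over `A`. -/
def ClosedOver [Nonempty M] (A : Set M) {α : Type x} (X : Set (α → M)) : Prop :=
  ∃ K : Set (TypeSpace L A α), IsClosed K ∧ X = {b | tp L A b ∈ K}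

/-- `X` is a Borel set over `A`: the set of realizations of a Borel set of types over `A`. -/
def BorelOver [Nonempty M] (A : Set M) {α : Type x} (X : Set (α → M)) : Prop :=
  ∃ K : Set (TypeSpace L A α), MeasurableSet K ∧ X = {b | tp L A b ∈ K}

end Definable

/-! ### Saturation, indiscernibility, NIP -/

section Ambient

variable (L : FirstOrder.Language.{u, v}) (M : Type w) [L.Structure M]

/-- `M` is `κ`-saturated: every finitely satisfiable family of subsets of `M ^ n` that are definable
over one set of fewer than `κ` parameters has a common point. -/
def IsSaturated (κ : Cardinal.{w}) : Prop :=
  ∀ (n : ℕ) (A : Set M), #A < κ → ∀ P : Set (Set (Fin n → M)),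
    (∀ D ∈ P, A.Definable L D) → (∀ F ⊆ P, F.Finite → (⋂₀ F).Nonempty) → (⋂₀ P).Nonempty

/-- `M` is a universal domain for its theory, "small" meaning "of cardinality less than `κ`":
`κ` is larger than the cardinality of the language and than the continuum, and `M` is
`κ`-saturated. -/
structure IsUniversalDomain (κ : Cardinal.{w}) : Prop where
  card_language_lt : Cardinal.lift.{w} L.card < Cardinal.lift.{max u v} κ
  continuum_lt : 𝔠 < κ
  saturated : IsSaturated L M κ

variable {M}

/-- The family of tuples `a i`, `i ∈ I`, is (order-)indiscernible over the empty set. -/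
def Indiscernible {α : Type x} {I : Type y} [Preorder I] (a : I → α → M) : Prop :=
  ∀ (n : ℕ) (φ : L.Formula (Fin n × α)) (i j : Fin n → I), StrictMono i → StrictMono j →
    (φ.Realize (fun p => a (i p.1) p.2) ↔ φ.Realize (fun p => a (j p.1) p.2))

variable (M)

/-- The independence property: some formula `φ(x, b)` with parameters is true exactly at the even
places of some indiscernible sequence of finite tuples. -/
def HasIP : Prop :=
  ∃ (n : ℕ) (a : ℕ → Fin n → M) (D : L.DefinableSet (univ : Set M) (Fin n)),
    Indiscernible L a ∧ ∀ i, a i ∈ D ↔ Even i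

/-- `NIP`: the theory of `M` does not have the independence property. -/
def NIP : Prop := ¬ HasIP L M

end Ambient

/-! ### Global Keisler measures -/

section Measures

variable {L : FirstOrder.Language.{u, v}} {M : Type w} [L.Structure M] {α : Type x} {β : Type y}

/-- `μ` is a global Keisler measure in the variables `α`: a finitely additive probability measure
on the Boolean algebra of formulas over `M`. -/
structure IsKeislerMeasure (μ : L.DefinableSet (univ : Set M) α → ℝ) : Prop where
  nonneg : ∀ D, 0 ≤ μ D
  top : μ ⊤ = 1
  sup : ∀ D E, Disjoint D E → μ (D ⊔ E) = μ D + μ E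

/-- `μ` is definable over `A`: for every parameter-free formula `φ(x, y)` and closed `C ⊆ [0, 1]`,
the set of `b` with `μ(φ(x, b)) ∈ C` is closed over `A`. -/
def DefinableOver [Nonempty M] (A : Set M) (μ : L.DefinableSet (univ : Set M) α → ℝ) : Prop :=
  ∀ (n : ℕ) (φ : L.Formula (α ⊕ Fin n)) (C : Set ℝ), IsClosed C → C ⊆ Icc 0 1 →
    ClosedOver (L := L) A {b : Fin n → M | μ (inst φ b) ∈ C}

/-- `μ` is Borel definable over `A`. -/
def BorelDefinableOver [Nonempty M] (A : Set M)
    (μ : L.DefinableSet (univ : Set M) α → ℝ) : Prop :=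
  ∀ (n : ℕ) (φ : L.Formula (α ⊕ Fin n)) (C : Set ℝ), IsClosed C → C ⊆ Icc 0 1 →
    BorelOver (L := L) A {b : Fin n → M | μ (inst φ b) ∈ C}

/-- `μ` is finitely satisfiable in a set `S` of tuples: every formula over `M` of positive measure
is satisfied by an element of `S`. -/
def FinitelySatisfiableIn (S : Set (α → M)) (μ : L.DefinableSet (univ : Set M) α → ℝ) : Prop :=
  ∀ D, 0 < μ D → ∃ c ∈ S, c ∈ D

/-- `μ` is generically stable: it is a global Keisler measure that is both definable over, and
finitely satisfiable in, some small elementary submodel `N` of `M`. -/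
def IsGenericallyStable [Nonempty M] (κ : Cardinal.{w})
    (μ : L.DefinableSet (univ : Set M) α → ℝ) : Prop :=
  IsKeislerMeasure μ ∧ ∃ N : L.ElementarySubstructure M, #N < κ ∧
    DefinableOver (N : Set M) μ ∧ FinitelySatisfiableIn {c | ∀ i, c i ∈ N} μ

/-! ### Products of measures -/

/-- The measure `ν` on the space of global types is the regular Borel probability measure
which corresponds to `μ`. -/
structure IsBorelExtension (μ : L.DefinableSet (univ : Set M) α → ℝ)
    (ν : Measure (TypeSpace L (univ : Set M) α)) : Prop where
  prob : IsProbabilityMeasure ν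
  regular : ν.Regular
  eq : ∀ D : L.DefinableSet (univ : Set M) α, ν.real (typesIn (D : Set (α → M))) = μ D

open Classical in
/-- The regular Borel probability measure on the space of global types that corresponds to a global
Keisler measure `μ`; it exists and is unique for every such `μ` (and `0` is a dummy value for
set functions `μ` that are not Keisler measures). -/
noncomputable def toBorel (μ : L.DefinableSet (univ : Set M) α → ℝ) :
    Measure (TypeSpace L (univ : Set M) α) :=
  if h : ∃ ν, IsBorelExtension μ ν then h.choose else 0

/-- For `μ` Borel definable over `A`, a definable set `D` of pairs `(x, y)` and a global type
`q(y)`: the measure of `D(x, b)`, where `b ⊨ q`, for the extension of `μ` to `M ∪ {b}` given by the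
same Borel definition. If `B` consists of `A` together with finitely many parameters
over which `D` is defined, this is the common value of `μ (D(x, b))` for all `b` in `M` that
realize the restriction of `q` to `B`. -/
noncomputable def extValue (A : Set M) (μ : L.DefinableSet (univ : Set M) α → ℝ)
    (D : L.DefinableSet (univ : Set M) (α ⊕ β)) (q : TypeSpace L (univ : Set M) β) : ℝ :=
  Classical.epsilon fun r => ∃ B : Set M, A ⊆ B ∧ (B \ A).Finite ∧
    B.Definable L (D : Set (α ⊕ β → M)) ∧ ∃ b : β → M, RealizesOver B q b ∧ r = μ (fiber D b)

/-- The nonforking product `μ(x) ⊗ lam(y)`, for `μ` Borel definable over `A`, obtained by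
integrating `q ↦ extValue A μ D q` along `lam`. -/
noncomputable def prod (A : Set M) (μ : L.DefinableSet (univ : Set M) α → ℝ)
    (lam : L.DefinableSet (univ : Set M) β → ℝ) : L.DefinableSet (univ : Set M) (α ⊕ β) → ℝ :=
  fun D => ∫ q, extValue A μ D q ∂(toBorel lam)

/-- The variables `(x_1, …, x_{n+1})`, split into the last one and the first `n`. -/
def splitLast (α : Type x) (n : ℕ) : Fin (n + 1) × α → α ⊕ (Fin n × α) :=
  fun p => Fin.lastCases (motive := fun _ => α ⊕ (Fin n × α)) (Sum.inl p.2)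
    (fun j => Sum.inr (j, p.2)) p.1

open Classical in
/-- The powers `μ^(n)` in the variables `(x_1, …, x_n)`, with
`μ^(n+1)(x_1, …, x_{n+1}) = μ(x_{n+1}) ⊗ μ^(n)(x_1, …, x_n)`. The recursion starts
with the only measure in the empty tuple of variables (so that `μ^(1) = μ`). -/
noncomputable def power (A : Set M) (μ : L.DefinableSet (univ : Set M) α → ℝ) :
    (n : ℕ) → L.DefinableSet (univ : Set M) (Fin n × α) → ℝ
  | 0 => fun D => if D = ⊤ then 1 else 0
  | n + 1 => fun D => prod A μ (power A μ n) (pullback (splitLast α n) D)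

/-! ### Frequency interpretation measures -/

/-- `Fr(D; c_1, …, c_m)`: the proportion of the `c_i` that lie in `D`. -/
noncomputable def freq {m : ℕ} (D : L.DefinableSet (univ : Set M) α) (c : Fin m → α → M) : ℝ :=
  ({i | c i ∈ D} : Set (Fin m)).ncard / m

/-- `μ` is `fim` (a frequency interpretation measure): it is a global Keisler measure, Borel
definable over a small set, and for every parameter-free formula `φ(x, y)` and `ε > 0` there are
formulas with parameters `θ_m(x_1, …, x_m)` such that `μ^(m)(θ_m) → 1` and, for all
sufficiently large `m`, any `(c_1, …, c_m) ⊨ θ_m` approximates `μ(φ(x, b))` within `ε`, for all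
`b`. -/
def IsFim [Nonempty M] (κ : Cardinal.{w}) (μ : L.DefinableSet (univ : Set M) α → ℝ) : Prop :=
  IsKeislerMeasure μ ∧ ∃ A : Set M, #A < κ ∧ BorelDefinableOver A μ ∧
    ∀ (n : ℕ) (φ : L.Formula (α ⊕ Fin n)) (ε : ℝ), 0 < ε →
      ∃ θ : (m : ℕ) → L.DefinableSet (univ : Set M) (Fin m × α),
        Tendsto (fun m => power A μ m (θ m)) atTop (𝓝 1) ∧
        ∀ᶠ m in atTop, ∀ c : Fin m → α → M, Function.uncurry c ∈ θ m →
          ∀ b : Fin n → M, |μ (inst φ b) - freq (inst φ b) c| < ε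

/-! ### The measure of an indiscernible segment -/

/-- For a family of tuples indexed by `[0, 1]`, the measure of a formula over `M` is the Lebesgue
measure of the set of `i ∈ [0, 1]` such that `a i` satisfies it. -/
noncomputable def segmentMeasure (a : unitInterval → α → M) :
    L.DefinableSet (univ : Set M) α → ℝ :=
  fun D => (volume : Measure unitInterval).real {i | a i ∈ D}

end Measures

end KeislerMeasures

/-!
Fix a formula `φ(x, y)`. By NIP, saturation and indiscernibility there is a bound `N`, independent
of `b`, on the number of times that the truth value of `φ(a i, b)` alternates along the segment
(`exists_not_alternates`): arbitrarily long alternations could be moved onto the initial parts of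
one increasing sequence of indices, and a `b` alternating along the whole sequence would exist by
compactness. Hence the truth set has finitely many convex components, and, if `[0, 1]` is cut into
`k` equal cells, at most `N` cells contain both values. The Lebesgue measure of the truth set
therefore differs by at most `N / k` from its frequency on the points `j / k`
(`abs_volume_real_sub_gridFreq_le`). These grid frequencies depend on `b` only through the truth
values of finitely many formulas over the segment, so `μ(φ(x, b))` is a uniform limit of functions
definable over the segment. This gives definability, and, by Löwenheim–Skolem, generic stability.

For `fim` the powers of `μ` have to be evaluated. A Keisler measure has a regular Borel extension,
built from the content `K ↦ inf {μ D : K ⊆ typesIn D}`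
(`IsKeislerMeasure.isBorelExtension_toBorel`). The integrand in the product `μ ⊗ lam` is, up to `N
/ k`, an average of indicator functions of clopen sets of types, so `(μ ⊗ lam)(D)` is the limit of
the averages over `j < k` of `lam {y : (a (j / k), y) ∈ D}` (`tendsto_gridAverage`). By induction,
a definable set that contains all tuples of points of the segment whose cells spell a word of `W`
has measure at least `|W| / k ^ n` under `μ^(n)` (`card_div_le_power`). The formula `θ_m` says of
`c` that, for all `y`, the frequency of `φ(x, y)` in `c` is close to its frequency on a fixed fine
grid. It holds for tuples whose cells spell a word with almost equal letter frequencies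
(`abs_freq_sub_gridFreq_le`), and Chebyshev's inequality shows that the proportion of these words
tends to `1` (`one_sub_le_card_balancedWords`).
-/

namespace KeislerMeasures

open Set MeasureTheory Filter Topology FirstOrder FirstOrder.Language
open scoped Cardinal

/-! ### Global types and the clopen sets `typesIn D` -/

section Types

variable {L : FirstOrder.Language.{u, v}} {M : Type w} [L.Structure M] [Nonempty M] {α : Type x}

omit [Nonempty M] in
theorem definable_coe (D : L.DefinableSet (univ : Set M) α) :
    (univ : Set M).Definable L (D : Set (α → M)) :=
  D.2

/-- A formula that belongs to a complete type over the theory of `M` is satisfied in `M`. -/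
theorem exists_realize_of_mem_completeType (q : (L.completeTheory M).CompleteType α)
    {φ : L.Formula α} (h : Formula.equivSentence φ ∈ q) : ∃ v : α → M, φ.Realize v := by
  classical
  obtain ⟨N, v, rfl⟩ := Theory.exists_modelType_is_realized_in _ q
  rw [Theory.CompleteType.formula_mem_typeOf] at h
  have hN : φ.exClosure.Realize N := by
    rw [← Formula.exists_realize_equivSentence_iff_realize_exClosure]
    refine ⟨v, ?_⟩
    rw [← Formula.realize_equivSentence_symm]
    simpa using h
  have hM : φ.exClosure.Realize M := by
    by_contra hc
    have hmem : φ.exClosure.not ∈ L.completeTheory M := by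
      rw [mem_completeTheory]; simpa [Sentence.Realize, Formula.Realize] using hc
    have := N.is_model.realize_of_mem _ hmem
    simp [Sentence.Realize, Formula.Realize] at this hN
    exact this hN
  rw [← Formula.exists_realize_equivSentence_iff_realize_exClosure] at hM
  obtain ⟨w, hw⟩ := hM
  refine ⟨w, ?_⟩
  rw [← Formula.realize_equivSentence_symm] at hw
  simpa using hw

omit [Nonempty M] in
theorem equivSentence_inf_mem_iff (q : (L.completeTheory M).CompleteType α) {φ ψ : L.Formula α} :
    Formula.equivSentence (φ ⊓ ψ) ∈ q ↔
      Formula.equivSentence φ ∈ q ∧ Formula.equivSentence ψ ∈ q := by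
  obtain ⟨N, v, rfl⟩ := Theory.exists_modelType_is_realized_in _ q
  simp only [Theory.CompleteType.formula_mem_typeOf]
  exact Formula.realize_inf

omit [Nonempty M] in
theorem equivSentence_not_mem_iff (q : (L.completeTheory M).CompleteType α) {φ : L.Formula α} :
    Formula.equivSentence φ.not ∈ q ↔ Formula.equivSentence φ ∉ q := by
  obtain ⟨N, v, rfl⟩ := Theory.exists_modelType_is_realized_in _ q
  simp only [Theory.CompleteType.formula_mem_typeOf]
  exact Formula.realize_not

/-- Membership in `typesIn D` can be tested on any formula that defines `D`. -/
theorem mem_typesIn_ofPred (q : TypeSpace L (univ : Set M) α)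
    (φ : L[[(univ : Set M)]].Formula α) :
    q ∈ typesIn {v | φ.Realize v} ↔ Formula.equivSentence φ ∈ q := by
  refine ⟨?_, fun h => ⟨φ, rfl, h⟩⟩
  rintro ⟨ψ, hψ, hq⟩
  by_contra hc
  rw [← equivSentence_not_mem_iff] at hc
  obtain ⟨v, hv⟩ := exists_realize_of_mem_completeType q
    ((equivSentence_inf_mem_iff q).2 ⟨hq, hc⟩)
  rw [Formula.realize_inf, Formula.realize_not] at hv
  exact hv.2 ((Set.ext_iff.1 hψ v).2 hv.1)

theorem typesIn_ofPred (φ : L[[(univ : Set M)]].Formula α) :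
    typesIn {v | φ.Realize v} =
      (L[[(univ : Set M)]].completeTheory M).typesWith (Formula.equivSentence φ) :=
  Set.ext fun q => mem_typesIn_ofPred q φ

theorem isClopen_typesIn {D : Set (α → M)} (hD : (univ : Set M).Definable L D) :
    IsClopen (typesIn (L := L) D) := by
  obtain ⟨φ, rfl⟩ := hD
  rw [typesIn_ofPred]
  exact CompleteType.isClopen_typesWith _

theorem typesIn_inter {D E : Set (α → M)} (hD : (univ : Set M).Definable L D)
    (hE : (univ : Set M).Definable L E) :
    typesIn (L := L) (D ∩ E) = typesIn D ∩ typesIn E := by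
  obtain ⟨φ, rfl⟩ := hD
  obtain ⟨ψ, rfl⟩ := hE
  have h : {v : α → M | φ.Realize v} ∩ {v | ψ.Realize v} = {v | (φ ⊓ ψ).Realize v} := by
    ext v; simp [Formula.realize_inf]
  rw [h]
  ext q
  simp only [mem_inter_iff, mem_typesIn_ofPred, equivSentence_inf_mem_iff]

theorem typesIn_compl {D : Set (α → M)} (hD : (univ : Set M).Definable L D) :
    typesIn (L := L) Dᶜ = (typesIn D)ᶜ := by
  obtain ⟨φ, rfl⟩ := hD
  have h : {v : α → M | φ.Realize v}ᶜ = {v | φ.not.Realize v} := by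
    ext v; simp [Formula.realize_not]
  rw [h]
  ext q
  simp only [mem_compl_iff, mem_typesIn_ofPred, equivSentence_not_mem_iff]

theorem nonempty_of_mem_typesIn {D : Set (α → M)} {q : TypeSpace L (univ : Set M) α}
    (h : q ∈ typesIn D) : D.Nonempty := by
  obtain ⟨φ, rfl, hφ⟩ := h
  exact exists_realize_of_mem_completeType q hφ

theorem typesIn_union {D E : Set (α → M)} (hD : (univ : Set M).Definable L D)
    (hE : (univ : Set M).Definable L E) :
    typesIn (L := L) (D ∪ E) = typesIn D ∪ typesIn E := by
  rw [← compl_inj_iff, ← typesIn_compl (hD.union hE), compl_union, compl_union,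
    typesIn_inter hD.compl hE.compl, typesIn_compl hD, typesIn_compl hE]

theorem typesIn_empty : typesIn (L := L) (∅ : Set (α → M)) = ∅ :=
  eq_empty_of_forall_notMem fun _ h => (nonempty_of_mem_typesIn h).ne_empty rfl

theorem typesIn_univ : typesIn (L := L) (univ : Set (α → M)) = univ := by
  simpa [typesIn_empty] using typesIn_compl (L := L) (α := α) (M := M) definable_empty

/-- Passing from definable sets to clopen sets of types loses no information, since every element
of `D` has a type. -/
theorem typesIn_subset_typesIn_iff {D E : Set (α → M)} (hD : (univ : Set M).Definable L D)
    (hE : (univ : Set M).Definable L E) : typesIn (L := L) D ⊆ typesIn E ↔ D ⊆ E := by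
  obtain ⟨φ, rfl⟩ := hD
  obtain ⟨ψ, rfl⟩ := hE
  constructor
  · intro h v hv
    have hq : tp L (univ : Set M) v ∈ typesIn {v | φ.Realize v} :=
      (mem_typesIn_ofPred _ _).2 (Theory.CompleteType.formula_mem_typeOf.2 hv)
    exact Theory.CompleteType.formula_mem_typeOf.1 ((mem_typesIn_ofPred _ _).1 (h hq))
  · intro h q hq
    rw [← inter_eq_left] at h
    rw [← h, typesIn_inter ⟨φ, rfl⟩ ⟨ψ, rfl⟩] at hq
    exact hq.2

/-- The sets `typesIn D` separate a compact set of types from an open set around it. -/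
theorem exists_typesIn_between {K U : Set (TypeSpace L (univ : Set M) α)} (hK : IsCompact K)
    (hU : IsOpen U) (hKU : K ⊆ U) :
    ∃ D : L.DefinableSet (univ : Set M) α, K ⊆ typesIn (D : Set (α → M)) ∧
      typesIn (D : Set (α → M)) ⊆ U := by
  refine hK.induction_on (p := fun s => ∃ D : L.DefinableSet (univ : Set M) α,
      s ⊆ typesIn (D : Set (α → M)) ∧ typesIn (D : Set (α → M)) ⊆ U) ?_ ?_ ?_ ?_
  · exact ⟨⊥, empty_subset _, by simp [typesIn_empty]⟩
  · rintro s t hst ⟨D, h1, h2⟩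
    exact ⟨D, hst.trans h1, h2⟩
  · rintro s t ⟨D, h1, h2⟩ ⟨E, h3, h4⟩
    refine ⟨D ⊔ E, ?_, ?_⟩
    · rw [DefinableSet.coe_sup, typesIn_union (definable_coe D) (definable_coe E)]
      exact union_subset_union h1 h3
    · rw [DefinableSet.coe_sup, typesIn_union (definable_coe D) (definable_coe E)]
      exact union_subset h2 h4
  · intro q hq
    obtain ⟨_, ⟨φ, rfl⟩, hqφ, hφU⟩ :=
      CompleteType.isTopologicalBasis_range_typesWith.exists_subset_of_mem_open (hKU hq) hU
    refine ⟨_, mem_nhdsWithin_of_mem_nhds ((CompleteType.isOpen_typesWith φ).mem_nhds hqφ),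
      ⟨{v | (Formula.equivSentence.symm φ).Realize v}, ⟨_, rfl⟩⟩, ?_⟩
    change _ ⊆ typesIn {v | (Formula.equivSentence.symm φ).Realize v} ∧
      typesIn {v | (Formula.equivSentence.symm φ).Realize v} ⊆ U
    rw [typesIn_ofPred, Equiv.apply_symm_apply]
    exact ⟨subset_rfl, hφU⟩

end Types

/-! ### Sets that are type-definable over a set of parameters -/

section ClosedOver

variable {L : FirstOrder.Language.{u, v}} {M : Type w} [L.Structure M] [Nonempty M] {α : Type x}

/-- An intersection of sets definable over `A` is closed over `A`. -/
theorem closedOver_iInter {ι : Type*} {A : Set M} {D : ι → Set (α → M)}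
    (hD : ∀ i, A.Definable L (D i)) : ClosedOver (L := L) A (⋂ i, D i) := by
  choose φ hφ using hD
  refine ⟨⋂ i, (L[[A]].completeTheory M).typesWith (Formula.equivSentence (φ i)),
    isClosed_iInter fun i => CompleteType.isClosed_typesWith _, ?_⟩
  ext b
  simp only [mem_iInter, mem_ofPred_eq, Theory.CompleteType.mem_typesWith_iff]
  refine forall_congr' fun i => ?_
  rw [hφ i]
  exact Theory.CompleteType.formula_mem_typeOf.symm

theorem DefinableOver.borelDefinableOver {A : Set M} {μ : L.DefinableSet (univ : Set M) α → ℝ}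
    (h : DefinableOver A μ) : BorelDefinableOver A μ := by
  intro n φ C hC hC'
  obtain ⟨K, hK, h⟩ := h n φ C hC hC'
  exact ⟨K, hK.measurableSet, h⟩

end ClosedOver

/-! ### Saturation -/

section Saturation

variable {L : FirstOrder.Language.{u, v}} {M : Type w} [L.Structure M] {κ : Cardinal.{w}}

/-- Saturation for tuples indexed by an arbitrary finite type. -/
theorem IsSaturated.nonempty_sInter (h : IsSaturated L M κ) {β : Type x} [Finite β] {A : Set M}
    (hA : #A < κ) {P : Set (Set (β → M))} (hP : ∀ D ∈ P, A.Definable L D)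
    (hfin : ∀ F ⊆ P, F.Finite → (⋂₀ F).Nonempty) : (⋂₀ P).Nonempty := by
  obtain ⟨n, ⟨e⟩⟩ := Finite.exists_equiv_fin β
  let f : (Fin n → M) → (β → M) := fun v => v ∘ e
  have hf : Function.Surjective f := fun v => ⟨v ∘ e.symm, by ext; simp [f]⟩
  have key : (⋂₀ ((fun D => f ⁻¹' D) '' P)).Nonempty := by
    refine h n A hA _ ?_ ?_
    · rintro _ ⟨D, hD, rfl⟩
      exact (hP D hD).preimage_comp e
    · intro F hF hFfin
      obtain ⟨G, hG, hGfin, rfl⟩ := exists_subset_image_finite_and.1 ⟨F, hF, hFfin, rfl⟩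
      obtain ⟨b, hb⟩ := hfin G hG hGfin
      obtain ⟨v, rfl⟩ := hf b
      refine ⟨v, ?_⟩
      rintro _ ⟨D, hD, rfl⟩
      exact hb D hD
  obtain ⟨v, hv⟩ := key
  exact ⟨f v, fun D hD => hv _ ⟨D, hD, rfl⟩⟩

/-- Over a small set, every global type is realized. -/
theorem IsSaturated.exists_realizesOver [Nonempty M] (h : IsSaturated L M κ) {β : Type x}
    [Finite β] {B : Set M} (hB : #B < κ) (q : TypeSpace L (univ : Set M) β) :
    ∃ b : β → M, RealizesOver B q b := by
  have hBu : ∀ {D : Set (β → M)}, B.Definable L D → (univ : Set M).Definable L D :=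
    fun hD => hD.mono (subset_univ B)
  have key : (⋂₀ {D : Set (β → M) | B.Definable L D ∧ q ∈ typesIn D}).Nonempty := by
    refine h.nonempty_sInter hB (fun D hD => hD.1) fun F hF hFfin => ?_
    suffices h : B.Definable L (⋂₀ F) ∧ q ∈ typesIn (⋂₀ F) from nonempty_of_mem_typesIn h.2
    induction F, hFfin using Set.Finite.induction_on with
    | empty => simp [typesIn_univ]
    | insert _ _ ih =>
      obtain ⟨h1, h2⟩ := ih ((subset_insert _ _).trans hF)
      obtain ⟨h3, h4⟩ := hF (mem_insert _ _)
      rw [sInter_insert]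
      exact ⟨h3.inter h1, by rw [typesIn_inter (hBu h3) (hBu h1)]; exact ⟨h4, h2⟩⟩
  obtain ⟨b, hb⟩ := key
  refine ⟨b, fun D hD => ⟨fun hq => hb D ⟨hD, hq⟩, fun hbD => ?_⟩⟩
  by_contra hq
  exact hb Dᶜ ⟨hD.compl, by rwa [typesIn_compl (hBu hD)]⟩ hbD

end Saturation

/-! ### Alternation along a linear order -/

section Alternation

variable {I : Type*} [LinearOrder I]

/-- Some increasing sequence of `N` points lies in `S` exactly at the even places. -/
def Alternates (N : ℕ) (S : Set I) : Prop :=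
  ∃ i : Fin N → I, StrictMono i ∧ ∀ l, i l ∈ S ↔ Even (l : ℕ)

/-- If each of `N` successive blocks contains a point `p l` of `S` and a point `q l` outside `S`,
then `S` alternates `N` times: choose `p` or `q` according to parity. -/
theorem alternates_of_blocks {N : ℕ} {S : Set I} (p q : Fin N → I) (hp : ∀ l, p l ∈ S)
    (hq : ∀ l, q l ∉ S) (h : ∀ l l', l < l' → max (p l) (q l) < min (p l') (q l')) :
    Alternates N S := by
  refine ⟨fun l => if Even (l : ℕ) then p l else q l, fun l l' hl => ?_, fun l => ?_⟩
  · have := h l l' hl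
    simp only [lt_min_iff, max_lt_iff] at this
    dsimp only
    split_ifs <;> tauto
  · by_cases hl : Even (l : ℕ) <;> simp [hl, hp, hq]

/-- A set with bounded alternation has finitely many convex components. -/
theorem exists_finite_ordConnected_of_not_alternates {N : ℕ} {S : Set I} (h : ¬ Alternates N S) :
    ∃ F : Set (Set I), F.Finite ∧ (∀ J ∈ F, J.OrdConnected) ∧ S = ⋃₀ F := by
  refine ⟨(fun x => ordConnectedComponent S x) '' ordConnectedSection S, ?_, ?_, ?_⟩
  · refine Set.Finite.image _ ?_
    by_contra hinf
    obtain ⟨t, ht, htc⟩ := Set.Infinite.exists_subset_card_eq hinf (N + 1)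
    let r := t.orderEmbOfFin htc
    have hr : ∀ l, r l ∈ ordConnectedSection S := fun l => ht (t.orderEmbOfFin_mem htc l)
    have hgap : ∀ l : Fin N, ∃ s, s ∉ S ∧ r l.castSucc < s ∧ s < r l.succ := by
      intro l
      have hlt : r l.castSucc < r l.succ := r.strictMono (Fin.castSucc_lt_succ (i := l))
      have hne : ¬ uIcc (r l.castSucc) (r l.succ) ⊆ S := fun hsub =>
        hlt.ne (eq_of_mem_ordConnectedSection_of_uIcc_subset (hr _) (hr _) hsub)
      obtain ⟨s, hs, hsS⟩ := not_subset.1 hne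
      rw [uIcc_of_le hlt.le] at hs
      refine ⟨s, hsS, lt_of_le_of_ne hs.1 ?_, lt_of_le_of_ne hs.2 ?_⟩
      · rintro rfl; exact hsS (ordConnectedSection_subset (hr _))
      · rintro rfl; exact hsS (ordConnectedSection_subset (hr _))
    choose s hsS hs1 hs2 using hgap
    refine h (alternates_of_blocks (fun l => r l.castSucc) s
      (fun l => ordConnectedSection_subset (hr _)) hsS fun l l' hl => ?_)
    have hle : r l.succ ≤ r l'.castSucc := r.monotone (by
      rw [Fin.le_iff_val_le_val]; simpa using Nat.succ_le_of_lt hl)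
    rw [max_eq_right (hs1 l).le, min_eq_left (hs1 l').le]
    exact (hs2 l).trans_le hle
  · rintro _ ⟨x, -, rfl⟩
    infer_instance
  · ext x
    simp only [sUnion_image, mem_iUnion, exists_prop]
    constructor
    · intro hx
      refine ⟨ordConnectedProj S ⟨x, hx⟩, ⟨⟨x, hx⟩, rfl⟩, ?_⟩
      exact mem_ordConnectedComponent_ordConnectedProj S ⟨x, hx⟩
    · rintro ⟨y, -, hy⟩
      exact ordConnectedComponent_subset hy

end Alternation

/-! ### Uniform grids on the unit interval -/

section Grid

/-- The point `j / k`. -/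
noncomputable def grid (k : ℕ) (j : Fin k) : unitInterval :=
  ⟨j / k, by positivity, div_le_one_of_le₀ (by exact_mod_cast j.2.le) (by positivity)⟩

/-- The half-open interval `[j / k, (j + 1) / k)`. -/
def cell (k : ℕ) (j : Fin k) : Set unitInterval :=
  {i | (j : ℝ) / k ≤ i ∧ (i : ℝ) < (j + 1) / k}

/-- The proportion of the points `j / k`, `j < k`, that lie in `S`. -/
noncomputable def gridFreq (S : Set unitInterval) (k : ℕ) : ℝ :=
  ∑ j : Fin k, S.indicator 1 (grid k j) / k

open Classical in
/-- The cells on which membership in `S` is not constant. -/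
noncomputable def mixedCells (S : Set unitInterval) (k : ℕ) : Finset (Fin k) :=
  {j | (cell k j ∩ S).Nonempty ∧ (cell k j \ S).Nonempty}

theorem mem_mixedCells {S : Set unitInterval} {k : ℕ} {j : Fin k} :
    j ∈ mixedCells S k ↔ (cell k j ∩ S).Nonempty ∧ (cell k j \ S).Nonempty := by
  simp [mixedCells]

theorem grid_mem_cell (k : ℕ) (j : Fin k) : grid k j ∈ cell k j := by
  have hk : (0 : ℝ) < k := by exact_mod_cast j.pos
  refine ⟨le_rfl, ?_⟩
  simp only [grid]
  gcongr
  linarith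

theorem lt_of_mem_cell {k : ℕ} {j j' : Fin k} (h : j < j') {p q : unitInterval}
    (hp : p ∈ cell k j) (hq : q ∈ cell k j') : p < q := by
  have hk : (0 : ℝ) < k := by exact_mod_cast j.pos
  have h1 : ((j : ℝ) + 1) / k ≤ j' / k := by
    gcongr
    exact_mod_cast h
  exact Subtype.coe_lt_coe.1 (hp.2.trans_le (h1.trans hq.1))

theorem card_mixedCells_le {N : ℕ} {S : Set unitInterval} (h : ¬ Alternates N S) (k : ℕ) :
    (mixedCells S k).card ≤ N := by
  by_contra! hlt
  let r := (mixedCells S k).orderEmbOfCardLe hlt.le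
  have hr : ∀ l, (∃ p, p ∈ cell k (r l) ∩ S) ∧ ∃ q, q ∈ cell k (r l) \ S := fun l =>
    mem_mixedCells.1 ((mixedCells S k).orderEmbOfCardLe_mem hlt.le l)
  choose p hp using fun l => (hr l).1
  choose q hq using fun l => (hr l).2
  refine h (alternates_of_blocks p q (fun l => (hp l).2) (fun l => (hq l).2) fun l l' hl => ?_)
  have hl' := r.strictMono hl
  simp only [lt_min_iff, max_lt_iff]
  exact ⟨⟨lt_of_mem_cell hl' (hp l).1 (hp l').1, lt_of_mem_cell hl' (hq l).1 (hp l').1⟩,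
    lt_of_mem_cell hl' (hp l).1 (hq l').1, lt_of_mem_cell hl' (hq l).1 (hq l').1⟩

theorem indicator_eq_of_notMem_mixedCells {S : Set unitInterval} {k : ℕ} {j : Fin k}
    (h : j ∉ mixedCells S k) {p : unitInterval} (hp : p ∈ cell k j) :
    S.indicator (1 : unitInterval → ℝ) p = S.indicator 1 (grid k j) := by
  simp only [mem_mixedCells, not_and_or,
    not_nonempty_iff_eq_empty, eq_empty_iff_forall_notMem, mem_inter_iff, Set.mem_sdiff,
    not_not] at h
  rcases h with h | h
  · rw [indicator_of_notMem ((h p).resolve_left (not_not.2 hp)),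
      indicator_of_notMem ((h _).resolve_left (not_not.2 (grid_mem_cell k j)))]
  · rw [indicator_of_mem ((h p).resolve_left (not_not.2 hp)),
      indicator_of_mem ((h _).resolve_left (not_not.2 (grid_mem_cell k j)))]
    rfl

open Classical in
/-- If the mass that each cell gives to `S` is, up to `δ`, the one predicted by its left endpoint,
save on the mixed cells, then the total mass is close to the grid frequency. -/
theorem abs_sum_sub_gridFreq_le {N k : ℕ} {S : Set unitInterval} (h : ¬ Alternates N S)
    (f : Fin k → ℝ) (δ : ℝ) (hf : ∀ j, |f j - S.indicator 1 (grid k j) / k| ≤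
      δ + if j ∈ mixedCells S k then 1 / (k : ℝ) else 0) :
    |∑ j, f j - gridFreq S k| ≤ k * δ + N / k := by
  rw [gridFreq, ← Finset.sum_sub_distrib]
  refine (Finset.abs_sum_le_sum_abs _ _).trans ((Finset.sum_le_sum fun j _ => hf j).trans ?_)
  rw [Finset.sum_add_distrib, Finset.sum_ite_mem, Finset.univ_inter, Finset.sum_const,
    Finset.sum_const, Finset.card_univ, Fintype.card_fin, nsmul_eq_mul, nsmul_eq_mul,
    mul_one_div]
  have : ((mixedCells S k).card : ℝ) ≤ N := by exact_mod_cast card_mixedCells_le h k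
  gcongr

theorem measurableSet_cell (k : ℕ) (j : Fin k) : MeasurableSet (cell k j) :=
  (measurableSet_le measurable_const measurable_subtype_coe).inter
    (measurableSet_lt measurable_subtype_coe measurable_const)

theorem volume_real_cell (k : ℕ) (j : Fin k) :
    (volume : Measure unitInterval).real (cell k j) = 1 / k := by
  have hk : (0 : ℝ) < k := by exact_mod_cast j.pos
  have himg : (Subtype.val '' cell k j : Set ℝ) = Ico ((j : ℝ) / k) ((j + 1) / k) := by
    ext r
    constructor
    · rintro ⟨i, hi, rfl⟩; exact hi
    · intro hr
      refine ⟨⟨r, le_trans (by positivity) hr.1, hr.2.le.trans ?_⟩, hr, rfl⟩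
      rw [div_le_one hk]
      exact_mod_cast j.2
  have hle : (j : ℝ) / k ≤ (j + 1) / k := by gcongr; linarith
  rw [Measure.real, unitInterval.volume_apply, himg, Real.volume_Ico,
    ENNReal.toReal_ofReal (by linarith)]
  ring

theorem iUnion_cell {k : ℕ} (hk : 0 < k) : ⋃ j, cell k j = {1}ᶜ := by
  have hk' : (0 : ℝ) < k := by exact_mod_cast hk
  ext i
  simp only [mem_iUnion, mem_compl_iff, mem_singleton_iff]
  constructor
  · rintro ⟨j, hj⟩ rfl
    have := hj.2
    rw [Set.Icc.coe_one, lt_div_iff₀ hk', one_mul] at this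
    have h2 : k < (j : ℕ) + 1 := by exact_mod_cast this
    have := j.2
    omega
  · intro hi
    have hi1 : (i : ℝ) < 1 := lt_of_le_of_ne i.2.2 fun h => hi (Subtype.ext h)
    have h0 : 0 ≤ (i : ℝ) * k := mul_nonneg i.2.1 hk'.le
    refine ⟨⟨⌊(i : ℝ) * k⌋₊, ?_⟩, ?_, ?_⟩
    · rw [Nat.floor_lt h0]
      nlinarith
    · rw [div_le_iff₀ hk']
      exact Nat.floor_le h0
    · rw [lt_div_iff₀ hk']
      exact Nat.lt_floor_add_one _

theorem volume_real_eq_sum_cells {k : ℕ} (hk : 0 < k) {S : Set unitInterval}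
    (hS : MeasurableSet S) : (volume : Measure unitInterval).real S =
      ∑ j : Fin k, (volume : Measure unitInterval).real (cell k j ∩ S) := by
  rw [← measureReal_iUnion_fintype (f := fun j => cell k j ∩ S), ← iUnion_inter, iUnion_cell hk]
  · refine (measureReal_congr ?_).symm
    rw [inter_comm]
    refine inter_ae_eq_left_of_ae_eq_univ ?_
    rw [eventuallyEq_univ, mem_ae_iff, compl_compl]
    exact measure_singleton _
  · intro j j' hj
    refine Set.disjoint_left.2 fun p hp hp' => ?_
    rcases lt_or_gt_of_ne hj with h | h
    · exact (lt_of_mem_cell h hp.1 hp'.1).false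
    · exact (lt_of_mem_cell h hp'.1 hp.1).false
  · exact fun j => (measurableSet_cell k j).inter hS

/-- The Lebesgue measure of a set with bounded alternation is a uniform limit of grid
frequencies. -/
theorem abs_volume_real_sub_gridFreq_le {N k : ℕ} (hk : 0 < k) {S : Set unitInterval}
    (hS : MeasurableSet S) (h : ¬ Alternates N S) :
    |(volume : Measure unitInterval).real S - gridFreq S k| ≤ N / k := by
  classical
  rw [volume_real_eq_sum_cells hk hS]
  refine (abs_sum_sub_gridFreq_le h _ 0 fun j => ?_).trans (by simp)
  have hle : (volume : Measure unitInterval).real (cell k j ∩ S) ≤ 1 / k := by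
    rw [← volume_real_cell k j]
    exact measureReal_mono inter_subset_left
  have h0 : 0 ≤ (volume : Measure unitInterval).real (cell k j ∩ S) := measureReal_nonneg
  by_cases hj : j ∈ mixedCells S k
  · rw [if_pos hj, zero_add, abs_le]
    by_cases hg : grid k j ∈ S <;> simp only [hg, indicator_of_mem, indicator_of_notMem,
      not_false_eq_true, Pi.one_apply, zero_div] <;> constructor <;> linarith
  · rw [if_neg hj, add_zero, abs_nonpos_iff, sub_eq_zero]
    have key := fun p hp => indicator_eq_of_notMem_mixedCells hj (p := p) hp
    by_cases hg : grid k j ∈ S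
    · have hsub : cell k j ∩ S = cell k j := inter_eq_left.2 fun p hp => by
        by_contra hpS
        simpa [hg, hpS] using key p hp
      rw [hsub, volume_real_cell, indicator_of_mem hg, Pi.one_apply]
    · have hsub : cell k j ∩ S = ∅ := eq_empty_of_forall_notMem fun p hp => by
        simpa [hg, hp.2] using key p hp.1
      rw [hsub, indicator_of_notMem hg]
      simp

theorem measurableSet_of_not_alternates {N : ℕ} {S : Set unitInterval} (h : ¬ Alternates N S) :
    MeasurableSet S := by
  obtain ⟨F, hF, hc, rfl⟩ := exists_finite_ordConnected_of_not_alternates h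
  exact MeasurableSet.sUnion hF.countable fun J hJ => (hc J hJ).measurableSet

end Grid

/-! ### Uniformly bounded alternation from NIP -/

section NIP

variable {L : FirstOrder.Language.{u, v}} {M : Type w} [L.Structure M]
  {α : Type x} {β : Type y}

theorem Definable.fiber_of_mem {A : Set M} {D : Set (α ⊕ β → M)} (hD : A.Definable L D)
    {c : α → M} (hc : ∀ i, c i ∈ A) : A.Definable L {b : β → M | Sum.elim c b ∈ D} := by
  rw [Set.definable_iff_exists_formula_sum] at hD ⊢
  obtain ⟨φ, rfl⟩ := hD
  refine ⟨φ.relabel (Sum.elim Sum.inl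
    (Sum.elim (fun j => Sum.inl ⟨c j, hc j⟩) Sum.inr)), ?_⟩
  ext b
  simp only [mem_ofPred_eq, Formula.realize_relabel]
  refine iff_of_eq (congrArg _ (funext fun i => ?_))
  rcases i with _ | _ | _ <;> rfl

theorem Definable.iff_const {A : Set M} {D : Set (α → M)} (hD : A.Definable L D) (p : Prop) :
    A.Definable L {v | v ∈ D ↔ p} := by
  by_cases hp : p
  · simpa [hp] using hD
  · simpa only [hp, iff_false] using! hD.compl

theorem Indiscernible.comp_strictMono {I J : Type*} [Preorder I] [Preorder J] {a : I → α → M}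
    (ha : Indiscernible L a) {t : J → I} (ht : StrictMono t) :
    Indiscernible L fun j => a (t j) :=
  fun n φ i j hi hj => ha n φ (t ∘ i) (t ∘ j) (ht.comp hi) (ht.comp hj)

theorem Indiscernible.comp_equiv {I : Type*} [Preorder I] {a : I → α → M}
    (ha : Indiscernible L a) (e : β ≃ α) : Indiscernible L fun j => a j ∘ e := by
  intro n φ i j hi hj
  have := ha n (φ.relabel (Prod.map id e)) i j hi hj
  simpa only [Formula.realize_relabel] using! this

theorem card_segment_lt {κ : Cardinal.{w}} (hκ : 𝔠 < κ) [Finite α] (a : unitInterval → α → M) :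
    #(⋃ i, range (a i) : Set M) < κ := by
  obtain ⟨n, ⟨e⟩⟩ := Finite.exists_equiv_fin α
  have hrange : (⋃ i, range (a i)) = range fun p : unitInterval × Fin n => a p.1 (e.symm p.2) := by
    ext m
    simp only [mem_iUnion, mem_range, Prod.exists]
    exact exists_congr fun i => (e.symm.exists_congr_right (q := fun j => a i j = m)).symm
  rw [hrange]
  refine lt_of_le_of_lt ?_ hκ
  have h1 := Cardinal.mk_range_le_lift
    (f := fun p : unitInterval × Fin n => a p.1 (e.symm p.2))
  have h2 : #(unitInterval × Fin n) ≤ 𝔠 := by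
    rw [Cardinal.mk_prod]
    simp only [Cardinal.lift_id, Cardinal.mk_fin]
    refine Cardinal.mul_le_of_le Cardinal.aleph0_le_continuum ?_ (Cardinal.nat_lt_continuum n).le
    exact (Cardinal.mk_set_le _).trans Cardinal.mk_real.le
  have h3 := h1.trans (Cardinal.lift_le.{w}.2 h2)
  simpa using h3

/-- Compactness turns unbounded alternation of the instances of a parameter-free formula into an
instance that alternates along a whole sequence, which is what NIP forbids. By indiscernibility the
finite alternating patterns can be moved to the initial parts of one fixed increasing sequence. -/
theorem exists_not_alternates_of_empty_definable {κ : Cardinal.{w}}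
    (hM : IsUniversalDomain L M κ) (hNIP : NIP L M) [Finite α] [Finite β]
    {a : unitInterval → α → M} (ha : Indiscernible L a) {D : Set (α ⊕ β → M)}
    (hD : (∅ : Set M).Definable L D) :
    ∃ N, ∀ b : β → M, ¬ Alternates N {i | Sum.elim (a i) b ∈ D} := by
  by_contra! hcon
  let t : ℕ → unitInterval := fun k =>
    ⟨k / (k + 1), by positivity, div_le_one_of_le₀ (by linarith) (by positivity)⟩
  have ht : StrictMono t := by
    refine strictMono_nat_of_lt_succ fun k => Subtype.coe_lt_coe.1 ?_
    simp only [t]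
    rw [div_lt_div_iff₀ (by positivity) (by positivity)]
    push_cast
    nlinarith
  have hpattern : ∀ N, ∃ b : β → M, ∀ l : Fin N, Sum.elim (a (t l)) b ∈ D ↔ Even (l : ℕ) := by
    intro N
    obtain ⟨b, i, hi, hib⟩ := hcon N
    have hdef : (∅ : Set M).Definable L {c : Fin N × α → M | ∃ b : β → M,
        ∀ l : Fin N, Sum.elim (fun j => c (l, j)) b ∈ D ↔ Even (l : ℕ)} := by
      have := Definable.exists_of_finite (definable_iInter_of_finite fun l : Fin N =>
        Definable.iff_const (hD.preimage_comp
          (Sum.map (fun j => (l, j)) id : α ⊕ β → (Fin N × α) ⊕ β)) (Even (l : ℕ)))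
      convert this using 5 with c b
      simp only [mem_iInter, mem_ofPred_eq, mem_preimage]
      refine forall_congr' fun l => iff_congr (iff_of_eq (congrArg (· ∈ D) ?_)) Iff.rfl
      funext z
      rcases z with _ | _ <;> rfl
    obtain ⟨φ, hφ⟩ := empty_definable_iff.1 hdef
    have h1 := Set.ext_iff.1 hφ fun p => a (i p.1) p.2
    have h2 := Set.ext_iff.1 hφ fun p => a (t p.1) p.2
    exact h2.2 ((ha N φ i (fun l => t l) hi fun _ _ h => ht h).1 (h1.1 ⟨b, hib⟩))
  have hsat : (⋂₀ range fun l : ℕ =>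
      {b : β → M | Sum.elim (a (t l)) b ∈ D ↔ Even l}).Nonempty := by
    refine hM.saturated.nonempty_sInter (card_segment_lt hM.continuum_lt a) ?_ ?_
    · rintro _ ⟨l, rfl⟩
      exact Definable.iff_const (Definable.fiber_of_mem (hD.mono (empty_subset _))
        fun j => mem_iUnion.2 ⟨t l, mem_range_self j⟩) _
    · intro F hF hFfin
      rw [← image_univ] at hF
      obtain ⟨s, -, hs, rfl⟩ := exists_subset_image_finite_and.1 ⟨F, hF, hFfin, rfl⟩
      obtain ⟨N, hN⟩ := hs.bddAbove
      obtain ⟨b, hb⟩ := hpattern (N + 1)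
      refine ⟨b, ?_⟩
      rintro _ ⟨l, hl, rfl⟩
      exact hb ⟨l, Nat.lt_succ_of_le (hN hl)⟩
  obtain ⟨b, hb⟩ := hsat
  obtain ⟨n, ⟨e⟩⟩ := Finite.exists_equiv_fin α
  refine hNIP ⟨n, fun k => a (t k) ∘ e.symm,
    pullback e (fiber ⟨D, hD.mono (empty_subset _)⟩ b),
    (ha.comp_strictMono ht).comp_equiv e.symm, fun l => ?_⟩
  have hbl := hb _ ⟨l, rfl⟩
  rw [mem_ofPred_eq] at hbl
  rw [← hbl]
  refine iff_of_eq (congrArg (· ∈ D) (congrArg (fun c => Sum.elim c b) ?_))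
  ext j
  simp

/-- The truth sets along the segment of the members of a definable family alternate a uniformly
bounded number of times. -/
theorem exists_not_alternates {κ : Cardinal.{w}} (hM : IsUniversalDomain L M κ) (hNIP : NIP L M)
    [Finite α] [Finite β] {a : unitInterval → α → M} (ha : Indiscernible L a)
    (D : L.DefinableSet (univ : Set M) (α ⊕ β)) :
    ∃ N, ∀ b : β → M, ¬ Alternates N {i | a i ∈ fiber D b} := by
  obtain ⟨A₀, -, hA₀⟩ := definable_iff_finitely_definable.1 (D.2)
  rw [definable_iff_exists_formula_sum] at hA₀
  obtain ⟨φ, hφ⟩ := hA₀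
  -- The parameters of `D` become variables, since `a` is indiscernible only over the empty set.
  let g : (A₀ : Set M) ⊕ (α ⊕ β) → α ⊕ ((A₀ : Set M) ⊕ β) :=
    Sum.elim (fun c => Sum.inr (Sum.inl c)) (Sum.map id Sum.inr)
  have hE : (∅ : Set M).Definable L {v | (φ.relabel g).Realize v} :=
    empty_definable_iff.2 ⟨_, rfl⟩
  obtain ⟨N, hN⟩ := exists_not_alternates_of_empty_definable hM hNIP ha hE
  refine ⟨N, fun b => ?_⟩
  convert hN (Sum.elim Subtype.val b) using 2
  ext i
  change Sum.elim (a i) b ∈ (D : Set (α ⊕ β → M)) ↔ _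
  rw [show (D : Set (α ⊕ β → M)) = _ from hφ, mem_ofPred_eq, mem_ofPred_eq, mem_ofPred_eq,
    Formula.realize_relabel]
  refine iff_of_eq (congrArg _ (funext fun z => ?_))
  rcases z with _ | _ | _ <;> rfl

/-- The version of `exists_not_alternates` for a single definable set. -/
theorem exists_not_alternates_definableSet {κ : Cardinal.{w}} (hM : IsUniversalDomain L M κ)
    (hNIP : NIP L M) [Finite α] {a : unitInterval → α → M} (ha : Indiscernible L a)
    (D : L.DefinableSet (univ : Set M) α) : ∃ N, ¬ Alternates N {i | a i ∈ D} := by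
  obtain ⟨N, hN⟩ := exists_not_alternates hM hNIP ha (pullback (Sum.inl : α → α ⊕ Empty) D)
  exact ⟨N, hN Empty.elim⟩

end NIP

/-! ### The measure of the segment -/

section Segment

variable {L : FirstOrder.Language.{u, v}} {M : Type w} [L.Structure M]
  {α : Type x} {β : Type y} {κ : Cardinal.{w}} {a : unitInterval → α → M}

theorem isKeislerMeasure_segmentMeasure (hM : IsUniversalDomain L M κ) (hNIP : NIP L M)
    [Finite α] (ha : Indiscernible L a) : IsKeislerMeasure (segmentMeasure (L := L) a) where
  nonneg D := measureReal_nonneg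
  top := by simp [segmentMeasure]
  sup D E h := by
    obtain ⟨N, hN⟩ := exists_not_alternates_definableSet hM hNIP ha E
    have hu : {i | a i ∈ D ⊔ E} = {i | a i ∈ D} ∪ {i | a i ∈ E} := by
      ext i; simp
    rw [segmentMeasure, hu]
    refine measureReal_union (Set.disjoint_left.2 fun i hD hE => ?_)
      (measurableSet_of_not_alternates hN)
    have : a i ∈ (⊥ : L.DefinableSet (univ : Set M) α) :=
      h.le_bot (DefinableSet.mem_inf.2 ⟨hD, hE⟩)
    exact DefinableSet.notMem_bot this

theorem finitelySatisfiableIn_segmentMeasure :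
    FinitelySatisfiableIn (range a) (segmentMeasure (L := L) a) := by
  intro D hD
  obtain ⟨i, hi⟩ := nonempty_of_measureReal_ne_zero hD.ne'
  exact ⟨a i, mem_range_self i, hi⟩

theorem FinitelySatisfiableIn.mono {S S' : Set (α → M)}
    {μ : L.DefinableSet (univ : Set M) α → ℝ} (h : FinitelySatisfiableIn S μ) (hS : S ⊆ S') :
    FinitelySatisfiableIn S' μ := fun D hD => by
  obtain ⟨c, hc, hcD⟩ := h D hD
  exact ⟨c, hS hc, hcD⟩

theorem abs_segmentMeasure_fiber_sub_gridFreq_le {D : L.DefinableSet (univ : Set M) (α ⊕ β)}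
    {N : ℕ} {b : β → M} (hN : ¬ Alternates N {i | a i ∈ fiber D b}) {k : ℕ} (hk : 0 < k) :
    |segmentMeasure a (fiber D b) - gridFreq {i | a i ∈ fiber D b} k| ≤ N / k :=
  abs_volume_real_sub_gridFreq_le hk (measurableSet_of_not_alternates hN) hN

/-- A condition on the truth values of finitely many definable sets is definable. -/
theorem definable_of_forall_mem_iff {A : Set M} {ι : Type*} [Finite ι] {E : ι → Set (β → M)}
    (hE : ∀ j, A.Definable L (E j)) {X : Set (β → M)}
    (hX : ∀ b b', (∀ j, b ∈ E j ↔ b' ∈ E j) → b ∈ X → b' ∈ X) : A.Definable L X := by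
  have hX' : X = ⋃ s : {s : Set ι // ∃ b ∈ X, s = {j | b ∈ E j}},
      ⋂ j, {b | b ∈ E j ↔ j ∈ s.1} := by
    ext b
    simp only [mem_iUnion, mem_iInter, mem_ofPred_eq, Subtype.exists, exists_prop]
    constructor
    · intro hb
      exact ⟨_, ⟨b, hb, rfl⟩, fun j => Iff.rfl⟩
    · rintro ⟨_, ⟨b', hb', rfl⟩, h⟩
      exact hX b' b (fun j => (h j).symm) hb'
  rw [hX']
  exact definable_iUnion_of_finite fun s => definable_iInter_of_finite fun j =>
    Definable.iff_const (hE j) _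

theorem gridFreq_congr {S S' : Set unitInterval} {k : ℕ}
    (h : ∀ j, grid k j ∈ S ↔ grid k j ∈ S') : gridFreq S k = gridFreq S' k := by
  classical
  refine Finset.sum_congr rfl fun j _ => ?_
  simp only [indicator_apply, h j]

theorem definableOver_segmentMeasure [Nonempty M] (hM : IsUniversalDomain L M κ)
    (hNIP : NIP L M) [Finite α] (ha : Indiscernible L a) {A : Set M} (hA : ∀ i j, a i j ∈ A) :
    DefinableOver A (segmentMeasure (L := L) a) := by
  intro n φ C hC _
  obtain ⟨N, hN⟩ := exists_not_alternates hM hNIP ha (ofFormula (M := M) φ)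
  -- The measure lies in `C` iff every grid frequency is as close to `C` as its error allows.
  have hX : {b : Fin n → M | segmentMeasure a (inst φ b) ∈ C} = ⋂ k : ℕ,
      {b | ∃ c ∈ C, |gridFreq {i | a i ∈ inst φ b} (k + 1) - c| ≤ N / ((k + 1 : ℕ) : ℝ)} := by
    ext b
    have happ := fun k : ℕ => abs_segmentMeasure_fiber_sub_gridFreq_le (hN b) k.succ_pos
    simp only [mem_iInter, mem_ofPred_eq]
    constructor
    · intro hb k
      exact ⟨_, hb, by rw [abs_sub_comm]; exact happ k⟩
    · intro hb
      rw [← hC.closure_eq, Metric.mem_closure_iff]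
      intro ε hε
      obtain ⟨k, hk⟩ := exists_nat_gt (2 * N / ε)
      obtain ⟨c, hc, hcb⟩ := hb k
      refine ⟨c, hc, ?_⟩
      have h1 := abs_sub_le (segmentMeasure a (inst φ b))
        (gridFreq {i | a i ∈ inst φ b} (k + 1)) c
      have h2 : (N : ℝ) / ((k + 1 : ℕ) : ℝ) + N / ((k + 1 : ℕ) : ℝ) < ε := by
        rw [← add_div, ← two_mul, div_lt_iff₀ (by positivity)]
        rw [div_lt_iff₀ hε] at hk
        push_cast
        nlinarith
      rw [Real.dist_eq]
      exact h1.trans_lt ((add_le_add (happ k) hcb).trans_lt h2)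
  rw [hX]
  refine closedOver_iInter fun k => ?_
  refine definable_of_forall_mem_iff (E := fun j : Fin (k + 1) =>
    {b : Fin n → M | Sum.elim (a (grid (k + 1) j)) b ∈ {v | φ.Realize v}})
    (fun j => Definable.fiber_of_mem
      ((empty_definable_iff.2 ⟨φ, rfl⟩).mono (empty_subset _)) (hA _)) ?_
  rintro b b' hbb' ⟨c, hc, hcb⟩
  refine ⟨c, hc, ?_⟩
  rw [← gridFreq_congr (S := {i | a i ∈ inst φ b}) hbb']
  exact hcb

/-- The downward Löwenheim–Skolem theorem in a universal domain. -/
theorem IsUniversalDomain.exists_elementarySubstructure (hM : IsUniversalDomain L M κ)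
    {A : Set M} (hA : #A < κ) : ∃ N : L.ElementarySubstructure M, A ⊆ N ∧ #N < κ := by
  let l : Cardinal.{max u v w} :=
    max ℵ₀ (max (Cardinal.lift.{max u v} #A) (Cardinal.lift.{w} L.card))
  have hl : l < Cardinal.lift.{max u v} κ := by
    refine max_lt ?_ (max_lt (Cardinal.lift_lt.2 hA) hM.card_language_lt)
    rw [← Cardinal.lift_aleph0.{max u v, w}, Cardinal.lift_lt]
    exact Cardinal.aleph0_lt_continuum.trans hM.continuum_lt
  by_cases hlM : l ≤ Cardinal.lift.{max u v} #M
  · obtain ⟨N, hAN, hN⟩ := exists_elementarySubstructure_card_eq L A l (le_max_left _ _)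
      (by simp [l]) (by simp [l])
      (by rw [Cardinal.lift_id'.{w, max u v w}, Cardinal.lift_umax.{w, max u v}]; exact hlM)
    refine ⟨N, hAN, ?_⟩
    rw [← Cardinal.lift_lt.{w, max u v}]
    rw [Cardinal.lift_id'.{w, max u v w}, Cardinal.lift_umax.{w, max u v}] at hN
    exact hN.trans_lt hl
  · refine ⟨⊤, fun _ _ => trivial, ?_⟩
    rw [← Cardinal.lift_lt.{w, max u v}]
    refine lt_of_le_of_lt (Cardinal.lift_le.2 ?_) ((not_le.1 hlM).trans hl)
    exact Cardinal.mk_subtype_le _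

theorem isGenericallyStable_segmentMeasure [Nonempty M] (hM : IsUniversalDomain L M κ)
    (hNIP : NIP L M) [Finite α] (ha : Indiscernible L a) :
    IsGenericallyStable κ (segmentMeasure (L := L) a) := by
  obtain ⟨N, hAN, hN⟩ := hM.exists_elementarySubstructure (card_segment_lt hM.continuum_lt a)
  have haN : ∀ i j, a i j ∈ (N : Set M) := fun i j => hAN (mem_iUnion.2 ⟨i, mem_range_self j⟩)
  refine ⟨isKeislerMeasure_segmentMeasure hM hNIP ha, N, hN,
    definableOver_segmentMeasure hM hNIP ha haN, finitelySatisfiableIn_segmentMeasure.mono ?_⟩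
  rintro _ ⟨i, rfl⟩ j
  exact haN i j

end Segment

/-! ### Keisler measures as regular Borel measures -/

section Content

open scoped NNReal ENNReal
open TopologicalSpace (Compacts)

variable {L : FirstOrder.Language.{u, v}} {M : Type w} [L.Structure M] {α : Type x} {β : Type y}
  {μ : L.DefinableSet (univ : Set M) α → ℝ}

theorem IsKeislerMeasure.mono (hμ : IsKeislerMeasure μ) {D E : L.DefinableSet (univ : Set M) α}
    (h : D ≤ E) : μ D ≤ μ E := by
  have := hμ.sup D (E \ D) disjoint_sdiff_self_right
  rw [sup_sdiff_cancel_right h] at this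
  linarith [hμ.nonneg (E \ D)]

theorem IsKeislerMeasure.sup_le (hμ : IsKeislerMeasure μ)
    (D E : L.DefinableSet (univ : Set M) α) : μ (D ⊔ E) ≤ μ D + μ E := by
  have h := hμ.sup D (E \ D) disjoint_sdiff_self_right
  rw [sup_sdiff_self_right] at h
  linarith [hμ.mono (sdiff_le : E \ D ≤ E)]

theorem IsKeislerMeasure.inf_add_sdiff (hμ : IsKeislerMeasure μ)
    (D E : L.DefinableSet (univ : Set M) α) : μ (D ⊓ E) + μ (D \ E) = μ D := by
  rw [← hμ.sup _ _ disjoint_inf_sdiff, sup_inf_sdiff]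

theorem IsKeislerMeasure.le_one (hμ : IsKeislerMeasure μ) (D : L.DefinableSet (univ : Set M) α) :
    μ D ≤ 1 :=
  hμ.top ▸ hμ.mono le_top

instance (K : Set (TypeSpace L (univ : Set M) α)) [Nonempty M] :
    Nonempty {D : L.DefinableSet (univ : Set M) α // K ⊆ typesIn (D : Set (α → M))} :=
  ⟨⊤, by rw [DefinableSet.coe_top, typesIn_univ]; exact subset_univ K⟩

/-- The outer value `inf {μ D : K ⊆ typesIn D}` of a set `K` of global types. -/
noncomputable def outerValue (μ : L.DefinableSet (univ : Set M) α → ℝ)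
    (K : Set (TypeSpace L (univ : Set M) α)) : ℝ≥0 :=
  ⨅ D : {D : L.DefinableSet (univ : Set M) α // K ⊆ typesIn (D : Set (α → M))}, (μ D).toNNReal

theorem outerValue_le {K : Set (TypeSpace L (univ : Set M) α)}
    {D : L.DefinableSet (univ : Set M) α} (h : K ⊆ typesIn (D : Set (α → M))) :
    outerValue μ K ≤ (μ D).toNNReal :=
  ciInf_le' (fun D : {D : L.DefinableSet (univ : Set M) α // K ⊆ typesIn (D : Set (α → M))} =>
    (μ D).toNNReal) ⟨D, h⟩

theorem IsKeislerMeasure.outerValue_union_le [Nonempty M] (hμ : IsKeislerMeasure μ)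
    (K₁ K₂ : Set (TypeSpace L (univ : Set M) α)) :
    outerValue μ (K₁ ∪ K₂) ≤ outerValue μ K₁ + outerValue μ K₂ := by
  refine NNReal.le_iInf_add_iInf fun D E => ?_
  refine (outerValue_le (D := D.1 ⊔ E.1) ?_).trans ?_
  · rw [DefinableSet.coe_sup, typesIn_union (definable_coe _) (definable_coe _)]
    exact union_subset_union D.2 E.2
  · rw [← Real.toNNReal_add (hμ.nonneg _) (hμ.nonneg _)]
    exact Real.toNNReal_le_toNNReal (hμ.sup_le _ _)

/-- The content on the space of global types induced by a Keisler measure. -/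
noncomputable def IsKeislerMeasure.content [Nonempty M] (hμ : IsKeislerMeasure μ) :
    Content (TypeSpace L (univ : Set M) α) where
  toFun K := outerValue μ K
  mono' K₁ K₂ h := le_ciInf fun D => outerValue_le (h.trans D.2)
  sup_le' K₁ K₂ := by
    rw [Compacts.coe_sup]
    exact hμ.outerValue_union_le _ _
  sup_disjoint' K₁ K₂ hK h₁ h₂ := by
    rw [Compacts.coe_sup]
    refine le_antisymm (hμ.outerValue_union_le _ _) (le_ciInf fun D => ?_)
    obtain ⟨E, hE₁, hE₂⟩ :=
      exists_typesIn_between K₁.isCompact h₂.isOpen_compl (subset_compl_iff_disjoint_right.2 hK)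
    obtain ⟨hD₁, hD₂⟩ := union_subset_iff.1 D.2
    rw [← hμ.inf_add_sdiff D.1 E, Real.toNNReal_add (hμ.nonneg _) (hμ.nonneg _)]
    refine add_le_add (outerValue_le ?_) (outerValue_le ?_)
    · rw [DefinableSet.coe_inf, typesIn_inter (definable_coe _) (definable_coe _)]
      exact subset_inter hD₁ hE₁
    · rw [DefinableSet.coe_sdiff, sdiff_eq, typesIn_inter (definable_coe _)
        (definable_coe _).compl, typesIn_compl (definable_coe _)]
      exact subset_inter hD₂ (subset_compl_comm.1 hE₂)

theorem IsKeislerMeasure.content_measure_typesIn [Nonempty M] (hμ : IsKeislerMeasure μ)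
    (D : L.DefinableSet (univ : Set M) α) :
    hμ.content.measure (typesIn (D : Set (α → M))) = ENNReal.ofReal (μ D) := by
  have hclopen := isClopen_typesIn (definable_coe D)
  rw [Content.measure_apply _ hclopen.isOpen.measurableSet,
    Content.outerMeasure_of_isOpen _ _ hclopen.isOpen,
    Content.innerContent_of_isCompact _ hclopen.isClosed.isCompact]
  change ((outerValue μ (typesIn (D : Set (α → M))) : ℝ≥0) : ℝ≥0∞) = ((μ D).toNNReal : ℝ≥0)
  refine congrArg _ (le_antisymm (outerValue_le subset_rfl) (le_ciInf fun E => ?_))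
  exact Real.toNNReal_le_toNNReal
    (hμ.mono ((typesIn_subset_typesIn_iff (definable_coe D) (definable_coe E.1)).1 E.2))

/-- Every Keisler measure extends to a regular Borel probability measure on the space of global
types. -/
theorem IsKeislerMeasure.isBorelExtension_toBorel [Nonempty M] (hμ : IsKeislerMeasure μ) :
    IsBorelExtension μ (toBorel μ) := by
  have hex : ∃ ν, IsBorelExtension μ ν := by
    refine ⟨hμ.content.measure, ⟨?_⟩, inferInstance, fun D => ?_⟩
    · have := hμ.content_measure_typesIn ⊤
      rwa [DefinableSet.coe_top, typesIn_univ, hμ.top, ENNReal.ofReal_one] at this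
    · rw [Measure.real, hμ.content_measure_typesIn, ENNReal.toReal_ofReal (hμ.nonneg D)]
  rw [toBorel, dif_pos hex]
  exact hex.choose_spec

end Content

/-! ### Products with the segment measure -/

section Product

variable {L : FirstOrder.Language.{u, v}} {M : Type w} [L.Structure M]
  {α : Type x} {β : Type y} {κ : Cardinal.{w}} {a : unitInterval → α → M}

/-- The definable set `{y : (c, y) ∈ D}`. -/
def leftFiber (D : L.DefinableSet (univ : Set M) (α ⊕ β)) (c : α → M) :
    L.DefinableSet (univ : Set M) β :=
  fiber (pullback Sum.swap D) c

theorem mem_leftFiber {D : L.DefinableSet (univ : Set M) (α ⊕ β)} {c : α → M} {b : β → M} :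
    b ∈ leftFiber D c ↔ Sum.elim c b ∈ D := by
  change Sum.elim b c ∘ Sum.swap ∈ D ↔ _
  refine iff_of_eq (congrArg (· ∈ D) (funext fun z => ?_))
  rcases z with _ | _ <;> rfl

/-- The average of the measures of the fibers of `D` over the first `k` points of a grid. -/
noncomputable def gridAverage (a : unitInterval → α → M)
    (lam : L.DefinableSet (univ : Set M) β → ℝ) (D : L.DefinableSet (univ : Set M) (α ⊕ β))
    (k : ℕ) : ℝ :=
  ∑ j : Fin k, lam (leftFiber D (a (grid k j))) / k

variable [Nonempty M]

/-- `extValue` is a uniform limit of locally constant functions of the type. Any `b` that realizes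
`q` over the parameters of `D` and the segment computes the same grid frequencies as `q`, so the
value does not depend on the choice of `b`. -/
theorem abs_extValue_sub_le (hM : IsUniversalDomain L M κ) [Finite α] [Finite β]
    {D : L.DefinableSet (univ : Set M) (α ⊕ β)} {N : ℕ}
    (hN : ∀ b : β → M, ¬ Alternates N {i | a i ∈ fiber D b}) {k : ℕ} (hk : 0 < k)
    (q : TypeSpace L (univ : Set M) β) :
    |extValue (⋃ i, range (a i)) (segmentMeasure a) D q -
      ∑ j : Fin k, (typesIn (leftFiber D (a (grid k j)) : Set (β → M))).indicator
        (1 : TypeSpace L (univ : Set M) β → ℝ) q / k| ≤ N / k := by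
  have hex : ∃ r : ℝ, ∃ B : Set M, (⋃ i, range (a i)) ⊆ B ∧ (B \ ⋃ i, range (a i)).Finite ∧
      B.Definable L (D : Set (α ⊕ β → M)) ∧
      ∃ b : β → M, RealizesOver B q b ∧ r = segmentMeasure a (fiber D b) := by
    obtain ⟨A₀, -, hA₀⟩ := definable_iff_finitely_definable.1 (definable_coe D)
    have hκ : ℵ₀ < κ := Cardinal.aleph0_lt_continuum.trans hM.continuum_lt
    have hB : #((⋃ i, range (a i)) ∪ (A₀ : Set M) : Set M) < κ :=
      (Cardinal.mk_union_le _ _).trans_lt (Cardinal.add_lt_of_lt hκ.le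
        (card_segment_lt hM.continuum_lt a) ((Cardinal.lt_aleph0_of_finite _).trans hκ))
    obtain ⟨b, hb⟩ := hM.saturated.exists_realizesOver hB q
    exact ⟨_, _, subset_union_left,
      A₀.finite_toSet.subset (by rw [union_sdiff_left]; exact sdiff_subset),
      hA₀.mono subset_union_right, b, hb, rfl⟩
  obtain ⟨B, hAB, -, hDB, b, hb, hr⟩ := Classical.epsilon_spec hex
  rw [extValue, hr]
  have hsum : ∑ j : Fin k, (typesIn (leftFiber D (a (grid k j)) : Set (β → M))).indicator
      (1 : TypeSpace L (univ : Set M) β → ℝ) q / k = gridFreq {i | a i ∈ fiber D b} k := by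
    classical
    refine Finset.sum_congr rfl fun j _ => ?_
    have hdef : B.Definable L (leftFiber D (a (grid k j)) : Set (β → M)) := by
      have := Definable.fiber_of_mem hDB (c := a (grid k j))
        fun z => hAB (mem_iUnion.2 ⟨_, mem_range_self z⟩)
      convert this using 1
      ext b
      exact mem_leftFiber
    have : q ∈ typesIn (leftFiber D (a (grid k j)) : Set (β → M)) ↔
        grid k j ∈ {i | a i ∈ fiber D b} := (hb _ hdef).trans mem_leftFiber
    simp only [indicator_apply, this]
    rfl
  rw [hsum]
  exact abs_segmentMeasure_fiber_sub_gridFreq_le (hN b) hk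

/-- Products with the segment measure are computed by averaging over grids. -/
theorem abs_prod_sub_gridAverage_le (hM : IsUniversalDomain L M κ) [Finite α] [Finite β]
    {D : L.DefinableSet (univ : Set M) (α ⊕ β)} {N : ℕ}
    (hN : ∀ b : β → M, ¬ Alternates N {i | a i ∈ fiber D b})
    {lam : L.DefinableSet (univ : Set M) β → ℝ} (hlam : IsKeislerMeasure lam)
    {k : ℕ} (hk : 0 < k) :
    |prod (⋃ i, range (a i)) (segmentMeasure a) lam D - gridAverage a lam D k| ≤ N / k := by
  have hν := hlam.isBorelExtension_toBorel
  have := hν.prob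
  set ν := toBorel lam
  let f : ℕ → TypeSpace L (univ : Set M) β → ℝ := fun k q =>
    ∑ j : Fin k, (typesIn (leftFiber D (a (grid k j)) : Set (β → M))).indicator
      (1 : TypeSpace L (univ : Set M) β → ℝ) q / k
  let e : TypeSpace L (univ : Set M) β → ℝ := extValue (⋃ i, range (a i)) (segmentMeasure a) D
  have hfe : ∀ {k : ℕ}, 0 < k → ∀ q, |e q - f k q| ≤ N / k := fun hk q =>
    abs_extValue_sub_le hM hN hk q
  have hmeas : ∀ E : L.DefinableSet (univ : Set M) β,
      MeasurableSet (typesIn (E : Set (β → M))) := fun E =>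
    (isClopen_typesIn (definable_coe E)).isOpen.measurableSet
  have hfi : ∀ k (j : Fin k), Integrable (fun q =>
      (typesIn (leftFiber D (a (grid k j)) : Set (β → M))).indicator
        (1 : TypeSpace L (univ : Set M) β → ℝ) q / k) ν := fun k j =>
    ((integrable_const (1 : ℝ)).indicator (hmeas _)).div_const _
  have hf : ∀ k, Integrable (f k) ν := fun k => integrable_finsetSum _ fun j _ => hfi k j
  have he : Integrable e ν := by
    have hlim : ∀ q, Tendsto (fun k : ℕ => f (k + 1) q) atTop (𝓝 (e q)) := by
      intro q
      rw [tendsto_iff_dist_tendsto_zero]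
      refine squeeze_zero (fun _ => dist_nonneg) (fun k => ?_)
        ((tendsto_const_div_atTop_nhds_zero_nat (N : ℝ)).comp (tendsto_add_atTop_nat 1))
      rw [dist_comm, Real.dist_eq]
      exact hfe k.succ_pos q
    have hm : AEStronglyMeasurable e ν :=
      aestronglyMeasurable_of_tendsto_ae atTop (fun k => (hf (k + 1)).aestronglyMeasurable)
        (Eventually.of_forall hlim)
    have hdiff : Integrable (fun q => e q - f 1 q) ν :=
      Integrable.of_bound (hm.sub (hf 1).aestronglyMeasurable) _
        (Eventually.of_forall fun q => hfe one_pos q)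
    exact (hdiff.add (hf 1)).congr (Eventually.of_forall fun q => sub_add_cancel _ _)
  have hint : ∫ q, f k q ∂ν = gridAverage a lam D k := by
    rw [integral_finsetSum _ fun j _ => hfi k j]
    refine Finset.sum_congr rfl fun j _ => ?_
    rw [integral_div, integral_indicator_one (hmeas _), hν.eq]
  rw [← hint, prod, ← integral_sub he (hf k)]
  simpa using norm_integral_le_of_norm_le_const (μ := ν) (f := fun q => e q - f k q)
    (Eventually.of_forall fun q => hfe hk q)

theorem tendsto_gridAverage (hM : IsUniversalDomain L M κ) (hNIP : NIP L M) [Finite α] [Finite β]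
    (ha : Indiscernible L a) {lam : L.DefinableSet (univ : Set M) β → ℝ}
    (hlam : IsKeislerMeasure lam) (D : L.DefinableSet (univ : Set M) (α ⊕ β)) :
    Tendsto (gridAverage a lam D) atTop
      (𝓝 (prod (⋃ i, range (a i)) (segmentMeasure a) lam D)) := by
  obtain ⟨N, hN⟩ := exists_not_alternates hM hNIP ha D
  rw [tendsto_iff_dist_tendsto_zero]
  refine squeeze_zero' (Eventually.of_forall fun _ => dist_nonneg) ?_
    (tendsto_const_div_atTop_nhds_zero_nat (N : ℝ))
  filter_upwards [eventually_gt_atTop 0] with k hk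
  rw [dist_comm, Real.dist_eq]
  exact abs_prod_sub_gridAverage_le hM hN hlam hk

theorem isKeislerMeasure_prod (hM : IsUniversalDomain L M κ) (hNIP : NIP L M) [Finite α]
    [Finite β] (ha : Indiscernible L a) {lam : L.DefinableSet (univ : Set M) β → ℝ}
    (hlam : IsKeislerMeasure lam) :
    IsKeislerMeasure (prod (⋃ i, range (a i)) (segmentMeasure (L := L) a) lam) where
  nonneg D := ge_of_tendsto' (tendsto_gridAverage hM hNIP ha hlam D) fun k =>
    Finset.sum_nonneg fun j _ => div_nonneg (hlam.nonneg _) k.cast_nonneg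
  top := by
    refine tendsto_nhds_unique (tendsto_gridAverage hM hNIP ha hlam ⊤)
      (tendsto_const_nhds.congr' ?_)
    filter_upwards [eventually_gt_atTop 0] with k hk
    have htop : ∀ c : α → M, leftFiber (⊤ : L.DefinableSet (univ : Set M) (α ⊕ β)) c = ⊤ :=
      fun c => rfl
    simp only [gridAverage, htop, hlam.top, Finset.sum_const, Finset.card_univ, Fintype.card_fin,
      nsmul_eq_mul]
    field_simp
  sup D E h := by
    refine tendsto_nhds_unique (tendsto_gridAverage hM hNIP ha hlam (D ⊔ E))
      (((tendsto_gridAverage hM hNIP ha hlam D).add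
        (tendsto_gridAverage hM hNIP ha hlam E)).congr fun k => ?_)
    simp only [gridAverage]
    rw [← Finset.sum_add_distrib]
    refine Finset.sum_congr rfl fun j _ => ?_
    rw [← add_div]
    have hsup : leftFiber (D ⊔ E) (a (grid k j)) =
        leftFiber D (a (grid k j)) ⊔ leftFiber E (a (grid k j)) := rfl
    rw [hsup, hlam.sup]
    rw [disjoint_iff] at h ⊢
    change leftFiber (D ⊓ E) (a (grid k j)) = ⊥
    rw [h]
    rfl

omit [Nonempty M] in
theorem IsKeislerMeasure.comp_pullback {γ : Type*} {μ : L.DefinableSet (univ : Set M) β → ℝ}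
    (hμ : IsKeislerMeasure μ) (g : γ → β) : IsKeislerMeasure fun D => μ (pullback g D) where
  nonneg D := hμ.nonneg _
  top := hμ.top
  sup D E h := by
    refine hμ.sup (pullback g D) (pullback g E) ?_
    rw [disjoint_iff] at h ⊢
    change pullback g (D ⊓ E) = ⊥
    rw [h]
    rfl

theorem isKeislerMeasure_power (hM : IsUniversalDomain L M κ) (hNIP : NIP L M) [Finite α]
    (ha : Indiscernible L a) (n : ℕ) :
    IsKeislerMeasure (power (⋃ i, range (a i)) (segmentMeasure (L := L) a) n) := by
  induction n with
  | zero =>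
    refine ⟨fun D => ?_, by simp [power], fun D E h => ?_⟩
    · simp only [power]; split_ifs <;> norm_num
    · have hbot : ∀ D : L.DefinableSet (univ : Set M) (Fin 0 × α), D = ⊤ ∨ D = ⊥ := by
        intro D
        rcases (D : Set (Fin 0 × α → M)).eq_empty_or_nonempty with hD | ⟨c, hc⟩
        · exact Or.inr (SetLike.coe_injective hD)
        · refine Or.inl (SetLike.coe_injective (eq_univ_of_forall fun c' => ?_))
          rwa [Subsingleton.elim c' c]
      have htb : (⊥ : L.DefinableSet (univ : Set M) (Fin 0 × α)) ≠ ⊤ := fun h =>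
        DefinableSet.notMem_bot (x := isEmptyElim) (h ▸ DefinableSet.mem_top)
      rcases hbot D with rfl | rfl <;> rcases hbot E with rfl | rfl <;>
        simp [power, htb] at h ⊢
      exact htb h.symm
  | succ n ih => exact (isKeislerMeasure_prod hM hNIP ha ih).comp_pullback _

end Product

/-! ### Words with almost equal letter frequencies -/

section Words

/-- The number of occurrences of the letter `c` in the word `w`. -/
noncomputable def letterCount {m k : ℕ} (w : Fin m → Fin k) (c : Fin k) : ℕ :=
  {l | w l = c}.ncard

theorem letterCount_eq_sum {m k : ℕ} (w : Fin m → Fin k) (c : Fin k) :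
    (letterCount w c : ℝ) = ∑ l, if w l = c then 1 else 0 := by
  rw [letterCount, ncard_eq_toFinset_card', Finset.sum_boole]
  simp

/-- The variance bound for sums of independent centred random variables, as a sum over words. -/
theorem sum_sq_sum_le {k : ℕ} (f : Fin k → ℝ) (h0 : ∑ c, f c = 0) (h1 : ∀ c, |f c| ≤ 1) (m : ℕ) :
    ∑ w : Fin m → Fin k, (∑ l, f (w l)) ^ 2 ≤ m * (k : ℝ) ^ m := by
  induction m with
  | zero => simp
  | succ m ih =>
    rw [← (Fin.consEquiv fun _ => Fin k).sum_comp, Fintype.sum_prod_type_right]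
    have hw : ∀ w : Fin m → Fin k, ∑ c, (∑ l, f (Fin.consEquiv (fun _ => Fin k) (c, w) l)) ^ 2 ≤
        k + k * (∑ l, f (w l)) ^ 2 := by
      intro w
      have hsq : ∑ c, f c ^ 2 ≤ k := by
        calc ∑ c, f c ^ 2 ≤ ∑ _c : Fin k, (1 : ℝ) :=
              Finset.sum_le_sum fun c _ => (sq_le_one_iff_abs_le_one _).2 (h1 c)
          _ = k := by simp
      have hcross : ∑ c, 2 * f c * ∑ l, f (w l) = 0 := by
        rw [← Finset.sum_mul, ← Finset.mul_sum, h0]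
        ring
      simp only [Fin.consEquiv_apply, Fin.sum_univ_succ, Fin.cons_zero, Fin.cons_succ, add_sq]
      rw [Finset.sum_add_distrib, Finset.sum_add_distrib, hcross, Finset.sum_const,
        Finset.card_univ, Fintype.card_fin, nsmul_eq_mul]
      linarith
    refine (Finset.sum_le_sum fun w _ => hw w).trans ?_
    rw [Finset.sum_add_distrib, ← Finset.mul_sum, Finset.sum_const, Finset.card_univ,
      Fintype.card_fun, Fintype.card_fin, Fintype.card_fin, nsmul_eq_mul]
    push_cast
    have := mul_le_mul_of_nonneg_left ih (Nat.cast_nonneg (α := ℝ) k)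
    rw [pow_succ]
    nlinarith

open Classical in
/-- The words in which every letter has frequency within `δ` of `1 / k`. -/
noncomputable def balancedWords (m k : ℕ) (δ : ℝ) : Finset (Fin m → Fin k) :=
  {w | ∀ c, |(letterCount w c : ℝ) / m - 1 / k| ≤ δ}

theorem mem_balancedWords {m k : ℕ} {δ : ℝ} {w : Fin m → Fin k} :
    w ∈ balancedWords m k δ ↔ ∀ c, |(letterCount w c : ℝ) / m - 1 / k| ≤ δ := by
  simp [balancedWords]

/-- Chebyshev's inequality for one letter. -/
theorem card_unbalanced_mul_le {m k : ℕ} (hm : 0 < m) {δ : ℝ} (hδ : 0 < δ) (c : Fin k)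
    (U : Finset (Fin m → Fin k)) (hU : ∀ w ∈ U, δ < |(letterCount w c : ℝ) / m - 1 / k|) :
    U.card * (δ ^ 2 * m) ≤ (k : ℝ) ^ m := by
  have hk : (0 : ℝ) < k := by exact_mod_cast c.pos
  have hm' : (0 : ℝ) < m := by exact_mod_cast hm
  let f : Fin k → ℝ := fun d => (if d = c then 1 else 0) - 1 / k
  have h0 : ∑ d, f d = 0 := by
    simp [f, Finset.sum_sub_distrib, hk.ne']
  have hk1 : 1 / (k : ℝ) ≤ 1 := by
    rw [div_le_one hk]
    exact_mod_cast c.pos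
  have hk0 : 0 < 1 / (k : ℝ) := by positivity
  have h1 : ∀ d, |f d| ≤ 1 := by
    intro d
    simp only [f]
    rw [abs_le]
    split_ifs <;> constructor <;> linarith
  have hf : ∀ w : Fin m → Fin k, ∑ l, f (w l) = m * ((letterCount w c : ℝ) / m - 1 / k) := by
    intro w
    simp only [f]
    rw [Finset.sum_sub_distrib, ← letterCount_eq_sum, Finset.sum_const, Finset.card_univ,
      Fintype.card_fin, nsmul_eq_mul]
    field_simp
  have hle : U.card * (m * δ) ^ 2 ≤ m * (k : ℝ) ^ m := by
    calc U.card * (m * δ) ^ 2 = ∑ _w ∈ U, (m * δ) ^ 2 := by simp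
      _ ≤ ∑ w ∈ U, (∑ l, f (w l)) ^ 2 := by
        refine Finset.sum_le_sum fun w hw => ?_
        rw [hf, mul_pow, mul_pow, ← sq_abs (_ - _)]
        have := hU w hw
        gcongr
      _ ≤ ∑ w : Fin m → Fin k, (∑ l, f (w l)) ^ 2 :=
        Finset.sum_le_univ_sum_of_nonneg fun w => sq_nonneg _
      _ ≤ _ := sum_sq_sum_le f h0 h1 m
  refine le_of_mul_le_mul_left ?_ hm'
  calc m * (U.card * (δ ^ 2 * m)) = U.card * (m * δ) ^ 2 := by ring
    _ ≤ _ := hle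

/-- The weak law of large numbers for letter frequencies. -/
theorem one_sub_le_card_balancedWords {m k : ℕ} (hm : 0 < m) (hk : 0 < k) {δ : ℝ} (hδ : 0 < δ) :
    1 - k / δ ^ 2 / m ≤ (balancedWords m k δ).card / (k : ℝ) ^ m := by
  classical
  have hk' : (0 : ℝ) < k := by exact_mod_cast hk
  have hm' : (0 : ℝ) < m := by exact_mod_cast hm
  let U : Fin k → Finset (Fin m → Fin k) := fun c => {w | δ < |(letterCount w c : ℝ) / m - 1 / k|}
  have hcompl : (balancedWords m k δ)ᶜ ⊆ Finset.univ.biUnion U := by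
    intro w hw
    rw [Finset.mem_compl, mem_balancedWords] at hw
    push Not at hw
    simpa [U] using hw
  have hcard : ((balancedWords m k δ)ᶜ.card : ℝ) * (δ ^ 2 * m) ≤ k * (k : ℝ) ^ m := by
    have h1 : ((balancedWords m k δ)ᶜ.card : ℝ) ≤ ∑ c, ((U c).card : ℝ) := by
      exact_mod_cast (Finset.card_le_card hcompl).trans Finset.card_biUnion_le
    calc ((balancedWords m k δ)ᶜ.card : ℝ) * (δ ^ 2 * m)
        ≤ (∑ c, ((U c).card : ℝ)) * (δ ^ 2 * m) := by gcongr
      _ = ∑ c, (U c).card * (δ ^ 2 * m) := Finset.sum_mul _ _ _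
      _ ≤ ∑ _c : Fin k, (k : ℝ) ^ m := Finset.sum_le_sum fun c _ =>
        card_unbalanced_mul_le hm hδ c (U c) fun w hw => (Finset.mem_filter.1 hw).2
      _ = _ := by simp
  have htot : ((balancedWords m k δ).card : ℝ) + (balancedWords m k δ)ᶜ.card = (k : ℝ) ^ m := by
    have := Finset.card_add_card_compl (balancedWords m k δ)
    rw [Fintype.card_fun, Fintype.card_fin, Fintype.card_fin] at this
    exact_mod_cast this
  rw [le_div_iff₀ (by positivity), sub_mul, one_mul, div_div, div_mul_eq_mul_div,
    sub_le_iff_le_add, ← sub_le_iff_le_add', le_div_iff₀ (by positivity)]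
  have : (k : ℝ) ^ m - (balancedWords m k δ).card = (balancedWords m k δ)ᶜ.card := by linarith
  rwa [this]

end Words

/-! ### Frequency interpretation -/

section Fim

variable {L : FirstOrder.Language.{u, v}} {M : Type w} [L.Structure M]
  {α : Type x} {β : Type y} {κ : Cardinal.{w}} {a : unitInterval → α → M}

theorem grid_mul_mem_cell {k t : ℕ} (c : Fin k) (s : Fin t) :
    grid (k * t) (finProdFinEquiv (c, s)) ∈ cell k c := by
  have hk : (0 : ℝ) < k := by exact_mod_cast c.pos
  have ht : (0 : ℝ) < t := by exact_mod_cast s.pos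
  have hs : (s : ℝ) < t := by exact_mod_cast s.2
  have hs0 : (0 : ℝ) ≤ s := by positivity
  constructor
  · simp only [grid, finProdFinEquiv_apply_val]
    push_cast
    rw [div_le_div_iff₀ hk (by positivity)]
    nlinarith [mul_nonneg hs0 hk.le]
  · simp only [grid, finProdFinEquiv_apply_val]
    push_cast
    rw [div_lt_div_iff₀ (by positivity) hk]
    nlinarith [mul_lt_mul_of_pos_right hs hk]

/-- If `D` contains every tuple `(a (i 1), …, a (i n))` whose indices lie in the cells spelled by
a word of `W`, then its measure is at least the volume `|W| / k ^ n` of the union of these boxes.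
In the inductive step the last variable is averaged over grids that refine the cells. -/
theorem card_div_le_power [Nonempty M] (hM : IsUniversalDomain L M κ) (hNIP : NIP L M) [Finite α]
    (ha : Indiscernible L a) {k : ℕ} (hk : 0 < k) (n : ℕ) (W : Finset (Fin n → Fin k))
    (D : L.DefinableSet (univ : Set M) (Fin n × α))
    (hD : ∀ w ∈ W, ∀ i : Fin n → unitInterval, (∀ l, i l ∈ cell k (w l)) →
      (fun p => a (i p.1) p.2) ∈ D) :
    (W.card : ℝ) / (k : ℝ) ^ n ≤
      power (⋃ i, range (a i)) (segmentMeasure (L := L) a) n D := by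
  classical
  induction n with
  | zero =>
    have hle : (W.card : ℝ) ≤ 1 := by exact_mod_cast Finset.card_le_one_of_subsingleton W
    rw [pow_zero, div_one]
    rcases W.eq_empty_or_nonempty with rfl | ⟨w, hw⟩
    · rw [Finset.card_empty, Nat.cast_zero]
      exact (isKeislerMeasure_power hM hNIP ha 0).nonneg D
    · have htop : D = ⊤ := SetLike.coe_injective (eq_univ_of_forall fun c => by
        have := hD w hw isEmptyElim fun l => l.elim0
        rwa [Subsingleton.elim c])
      simpa [power, htop] using hle
  | succ n ih =>
    have hk' : (0 : ℝ) < k := by exact_mod_cast hk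
    let V : Fin k → Finset (Fin n → Fin k) := fun c => {w | Fin.snoc w c ∈ W}
    have hV : ∑ c, (V c).card = W.card := by
      have hW : W.card = ∑ w, if w ∈ W then 1 else 0 := by simp
      rw [hW, ← (Fin.snocEquiv fun _ => Fin k).sum_comp, Fintype.sum_prod_type]
      refine Finset.sum_congr rfl fun c _ => ?_
      rw [Finset.card_filter]
      rfl
    set E := pullback (splitLast α n) D
    have hfib : ∀ c, ∀ p ∈ cell k c, ((V c).card : ℝ) / (k : ℝ) ^ n ≤
        power (⋃ i, range (a i)) (segmentMeasure (L := L) a) n (leftFiber E (a p)) := by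
      intro c p hp
      refine ih _ _ fun w hw i hi => ?_
      rw [mem_leftFiber]
      have := hD _ (Finset.mem_filter.1 hw).2 (Fin.snoc i p : Fin (n + 1) → unitInterval) ?_
      · refine (iff_of_eq (congrArg (· ∈ D) (funext fun z => ?_))).1 this
        obtain ⟨l, z⟩ := z
        induction l using Fin.lastCases with
        | last => simp [splitLast]
        | cast l => simp [splitLast]
      · intro l
        induction l using Fin.lastCases with
        | last => simpa using hp
        | cast l => simpa using hi l
    have havg : ∀ t : ℕ, 0 < t → (W.card : ℝ) / (k : ℝ) ^ (n + 1) ≤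
        gridAverage a (power (⋃ i, range (a i)) (segmentMeasure (L := L) a) n) E (k * t) := by
      intro t ht
      have ht' : (0 : ℝ) < t := by exact_mod_cast ht
      rw [gridAverage, ← finProdFinEquiv.sum_comp, Fintype.sum_prod_type]
      calc (W.card : ℝ) / (k : ℝ) ^ (n + 1)
          = ∑ c : Fin k, ∑ _s : Fin t, ((V c).card : ℝ) / (k : ℝ) ^ n / ((k * t : ℕ) : ℝ) := by
            rw [← hV]
            simp only [Finset.sum_const, Finset.card_univ, Fintype.card_fin, nsmul_eq_mul]
            push_cast
            rw [Finset.sum_div]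
            refine Finset.sum_congr rfl fun c _ => ?_
            field_simp
            ring
        _ ≤ _ := by
            refine Finset.sum_le_sum fun c _ => Finset.sum_le_sum fun s _ => ?_
            have := hfib c _ (grid_mul_mem_cell c s)
            gcongr
    have hlim := (tendsto_gridAverage hM hNIP ha (isKeislerMeasure_power hM hNIP ha n) E).comp
      (tendsto_id.const_mul_atTop' hk)
    refine ge_of_tendsto hlim ?_
    filter_upwards [eventually_gt_atTop 0] with t ht using havg t ht

theorem freq_eq_sum {m : ℕ} (D : L.DefinableSet (univ : Set M) α) (c : Fin m → α → M) :
    freq D c = ∑ l, (D : Set (α → M)).indicator (1 : (α → M) → ℝ) (c l) / m := by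
  classical
  rw [freq, ← Finset.sum_div, ncard_eq_toFinset_card']
  simp [indicator_apply]

theorem freq_congr {m : ℕ} {D E : L.DefinableSet (univ : Set M) α} {c d : Fin m → α → M}
    (h : ∀ l, c l ∈ D ↔ d l ∈ E) : freq D c = freq E d := by
  simp only [freq, h]

/-- On a tuple of points of the segment whose cells form a balanced word, the frequency of a set
of bounded alternation is close to the grid frequency. -/
theorem abs_freq_sub_gridFreq_le {m k N : ℕ} {δ : ℝ} {D : L.DefinableSet (univ : Set M) α}
    (hN : ¬ Alternates N {i | a i ∈ D}) {w : Fin m → Fin k} (hw : w ∈ balancedWords m k δ)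
    {i : Fin m → unitInterval} (hi : ∀ l, i l ∈ cell k (w l)) :
    |freq D (fun l => a (i l)) - gridFreq {i | a i ∈ D} k| ≤ k * δ + N / k := by
  classical
  set S : Set unitInterval := {i | a i ∈ D}
  have hsum : freq D (fun l => a (i l)) =
      ∑ c : Fin k, ∑ l, if w l = c then S.indicator (1 : unitInterval → ℝ) (i l) / m else 0 := by
    rw [freq_eq_sum, Finset.sum_comm]
    refine Finset.sum_congr rfl fun l _ => ?_
    rw [Finset.sum_ite_eq, if_pos (Finset.mem_univ _)]
    rfl
  rw [hsum]
  refine abs_sum_sub_gridFreq_le hN _ δ fun c => ?_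
  have hδ := mem_balancedWords.1 hw c
  by_cases hc : c ∈ mixedCells S k
  · rw [if_pos hc]
    have h0 : 0 ≤ ∑ l, if w l = c then S.indicator (1 : unitInterval → ℝ) (i l) / m else 0 :=
      Finset.sum_nonneg fun l _ => by
        split_ifs
        · exact div_nonneg (indicator_nonneg (fun _ _ => zero_le_one) _) m.cast_nonneg
        · exact le_rfl
    have h1 : (∑ l, if w l = c then S.indicator (1 : unitInterval → ℝ) (i l) / m else 0) ≤
        (letterCount w c : ℝ) / m := by
      rw [letterCount_eq_sum, Finset.sum_div]
      refine Finset.sum_le_sum fun l _ => ?_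
      split_ifs
      · have : S.indicator (1 : unitInterval → ℝ) (i l) ≤ 1 :=
          indicator_le_self' (fun _ _ => zero_le_one) _
        gcongr
      · rw [zero_div]
    have hk0 : 0 ≤ 1 / (k : ℝ) := by positivity
    have hδ0 := (abs_nonneg _).trans hδ
    rw [abs_le] at hδ ⊢
    by_cases hg : grid k c ∈ S <;> simp only [hg, indicator_of_mem, indicator_of_notMem,
      not_false_eq_true, Pi.one_apply, zero_div] <;> constructor <;> linarith
  · rw [if_neg hc, add_zero]
    have heq : (∑ l, if w l = c then S.indicator (1 : unitInterval → ℝ) (i l) / m else 0) =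
        S.indicator 1 (grid k c) * ((letterCount w c : ℝ) / m) := by
      rw [letterCount_eq_sum, Finset.sum_div, Finset.mul_sum]
      refine Finset.sum_congr rfl fun l _ => ?_
      by_cases hl : w l = c
      · rw [if_pos hl, if_pos hl, indicator_eq_of_notMem_mixedCells hc (hl ▸ hi l)]
        ring
      · simp [hl]
    rw [heq]
    by_cases hg : grid k c ∈ S
    · simpa [hg] using hδ
    · simpa [hg] using (abs_nonneg _).trans hδ

/-- The tuples whose frequencies are uniformly within `η` of the grid frequencies form a definable
set. -/
theorem definable_approximations (a : unitInterval → α → M) [Finite β] (φ : L.Formula (α ⊕ β))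
    (m k : ℕ) (η : ℝ) : (univ : Set M).Definable L {c : Fin m × α → M | ∀ b : β → M,
      |freq (inst φ b) (Function.curry c) - gridFreq {i | a i ∈ inst φ b} k| ≤ η} := by
  have hφ : (univ : Set M).Definable L {v | φ.Realize v} :=
    (empty_definable_iff.2 ⟨φ, rfl⟩).mono (empty_subset _)
  -- Membership depends only on the truth values at the variables and at the grid points.
  let E : Fin m ⊕ Fin k → Set ((Fin m × α) ⊕ β → M) := Sum.elim
    (fun l => {v | Sum.elim (fun j => v (Sum.inl (l, j))) (v ∘ Sum.inr) ∈ {v | φ.Realize v}})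
    (fun j => {v | Sum.elim (a (grid k j)) (v ∘ Sum.inr) ∈ {v | φ.Realize v}})
  have hE : ∀ j, (univ : Set M).Definable L (E j) := by
    rintro (l | j)
    · convert hφ.preimage_comp (Sum.map (fun j => (l, j)) id : α ⊕ β → (Fin m × α) ⊕ β) using 1
      ext v
      refine iff_of_eq (congrArg (· ∈ {v | φ.Realize v}) (funext fun z => ?_))
      rcases z with _ | _ <;> rfl
    · exact (Definable.fiber_of_mem hφ (c := a (grid k j)) fun _ => mem_univ _).preimage_comp
        (Sum.inr : β → (Fin m × α) ⊕ β)
  refine Definable.forall_of_finite (S := {v : (Fin m × α) ⊕ β → M |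
    |freq (inst φ (v ∘ Sum.inr)) (fun l j => v (Sum.inl (l, j))) -
      gridFreq {i | a i ∈ inst φ (v ∘ Sum.inr)} k| ≤ η})
    (definable_of_forall_mem_iff hE fun v v' h hv => ?_)
  have hfreq : freq (inst φ (v ∘ Sum.inr)) (fun l j => v (Sum.inl (l, j))) =
      freq (inst φ (v' ∘ Sum.inr)) fun l j => v' (Sum.inl (l, j)) :=
    freq_congr fun l => h (Sum.inl l)
  have hgrid : gridFreq {i | a i ∈ inst φ (v ∘ Sum.inr)} k =
      gridFreq {i | a i ∈ inst φ (v' ∘ Sum.inr)} k := gridFreq_congr fun j => h (Sum.inr j)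
  rw [mem_ofPred_eq] at hv ⊢
  rwa [← hfreq, ← hgrid]

theorem isFim_segmentMeasure [Nonempty M] (hM : IsUniversalDomain L M κ) (hNIP : NIP L M)
    [Finite α] (ha : Indiscernible L a) : IsFim κ (segmentMeasure (L := L) a) := by
  refine ⟨isKeislerMeasure_segmentMeasure hM hNIP ha, ⋃ i, range (a i),
    card_segment_lt hM.continuum_lt a, (definableOver_segmentMeasure hM hNIP ha fun i j =>
      mem_iUnion.2 ⟨i, mem_range_self j⟩).borelDefinableOver, fun n φ ε hε => ?_⟩
  obtain ⟨N, hN⟩ := exists_not_alternates hM hNIP ha (ofFormula (M := M) φ)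
  -- The grid is so fine that the mixed cells contribute less than `ε / 4`, and `δ` is such that
  -- the deviations of all `k` letter frequencies together contribute at most `ε / 4`.
  obtain ⟨k, hk⟩ := exists_nat_gt (max 0 (4 * N / ε))
  have hk0 : (0 : ℝ) < k := (le_max_left _ _).trans_lt hk
  have hk0' : 0 < k := by exact_mod_cast hk0
  have hkN : (N : ℝ) / k < ε / 4 := by
    have := (le_max_right _ _).trans_lt hk
    rw [div_lt_iff₀ hε] at this
    rw [div_lt_iff₀ hk0]
    linarith
  set δ : ℝ := ε / (4 * k)
  have hδ : 0 < δ := by positivity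
  have hkδ : k * δ = ε / 4 := by
    simp only [δ]
    field_simp
  refine ⟨fun m => ⟨_, definable_approximations a φ m k (k * δ + N / k)⟩, ?_,
    Eventually.of_forall fun m c hc b => ?_⟩
  · refine tendsto_of_tendsto_of_tendsto_of_le_of_le' (g := fun m : ℕ => 1 - k / δ ^ 2 / (m : ℝ))
      (h := fun _ => 1) ?_ tendsto_const_nhds ?_ ?_
    · simpa using (tendsto_const_div_atTop_nhds_zero_nat ((k : ℝ) / δ ^ 2)).const_sub 1
    · filter_upwards [eventually_gt_atTop 0] with m hm
      refine (one_sub_le_card_balancedWords hm hk0' hδ).trans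
        (card_div_le_power hM hNIP ha hk0' m _ _ fun w hw i hi b => ?_)
      exact abs_freq_sub_gridFreq_le (hN b) hw hi
    · exact Eventually.of_forall fun m => (isKeislerMeasure_power hM hNIP ha m).le_one _
  · have h1 := abs_segmentMeasure_fiber_sub_gridFreq_le (hN b) hk0'
    have h2 : |freq (inst φ b) c - gridFreq {i | a i ∈ inst φ b} k| ≤ k * δ + N / k := hc b
    rw [abs_sub_comm] at h2
    have h3 := abs_sub_le (segmentMeasure a (inst φ b)) (gridFreq {i | a i ∈ inst φ b} k)
      (freq (inst φ b) c)
    have h1' : |segmentMeasure a (inst φ b) - gridFreq {i | a i ∈ inst φ b} k| ≤ N / k := h1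
    linarith

end Fim

end KeislerMeasures

open KeislerMeasures in
theorem proposition3p7 {L : FirstOrder.Language.{u, v}} {M : Type w} [L.Structure M] [Nonempty M]
    (κ : Cardinal.{w}) (hM : IsUniversalDomain L M κ) (hNIP : NIP L M)
    {α : Type x} [Finite α] (a : unitInterval → α → M) (ha : Indiscernible L a) :
    -- the truth set of a formula along the segment is a finite union of intervals
    (∀ D : L.DefinableSet (Set.univ : Set M) α, ∃ F : Set (Set unitInterval),
      F.Finite ∧ (∀ J ∈ F, J.OrdConnected) ∧ {i | a i ∈ D} = ⋃₀ F) ∧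
    IsKeislerMeasure (segmentMeasure (L := L) a) ∧
    FinitelySatisfiableIn (Set.range a) (segmentMeasure (L := L) a) ∧
    DefinableOver (⋃ i, Set.range (a i)) (segmentMeasure (L := L) a) ∧
    IsGenericallyStable κ (segmentMeasure (L := L) a) ∧
    IsFim κ (segmentMeasure (L := L) a) := by
  refine ⟨fun D => ?_, isKeislerMeasure_segmentMeasure hM hNIP ha,
    finitelySatisfiableIn_segmentMeasure,
    definableOver_segmentMeasure hM hNIP ha fun i j => Set.mem_iUnion.2 ⟨i, Set.mem_range_self j⟩,
    isGenericallyStable_segmentMeasure hM hNIP ha, isFim_segmentMeasure hM hNIP ha⟩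
  obtain ⟨N, hN⟩ := exists_not_alternates_definableSet hM hNIP ha D
  exact exists_finite_ordConnected_of_not_alternates hN
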